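/- Let $\Omega\subset\mathbb R^d$ ($d\ge 1$) be open, let $\mu$ be a $\sigma$-finite Borel measure on $\mathbb R^d$ with support $V$, and put $\mathcal E=L^1(\Omega\times V,\mathrm dx\otimes\mathrm d\mu(v))$, with positive cone $\mathcal E_+$ and norm $\|\cdot\|$. Let $\Sigma:[0,\infty)\times V\to[0,\infty)$ be measurable, with $t\mapsto\Sigma(t,v)$ locally integrable on $[0,\infty)$ for $\mu$-almost every $v$, and let $b:[0,\infty)\times V\times V\to[0,\infty)$ be measurable with $$\sigma(t,v'):=\int_V b(t,v,v')\,\mathrm d\mu(v)\le\Sigma(t,v')\qquad\text{for almost every }(t,v')\in[0,\infty)\times V.$$ Set $\tau(x,v)=\inf\{t>0: x-tv\notin\Omega\}\in[0,\infty]$ and, for $t\ge s\ge 0$ and $f\in\mathcal E$, $$[U(t,s)f](x,v)=\exp\Big(-\int_s^t\Sigma(r,v)\,\mathrm dr\Big)f(x-(t-s)v,v)\,\mathbf 1_{\{t-s<\tau(x,v)\}} .$$ For $t\ge0$ let $[\Sigma(t)\varphi](x,v)=\Sigma(t,v)\varphi(x,v)$ with domain $D(\Sigma(t))=\{\varphi\in\mathcal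 E:\int_{\Omega\times V}\Sigma(t,v)|\varphi(x,v)|\,\mathrm dx\,\mathrm d\mu(v)<\infty\}$, and $[B(t)\varphi](x,v)=\int_V b(t,v,v')\varphi(x,v')\,\mathrm d\mu(v')$ with domain $D(B(t))=\{\varphi\in\mathcal E:\int_{\Omega\times V}\sigma(t,v)|\varphi(x,v)|\,\mathrm dx\,\mathrm d\mu(v)<\infty\}$. Then: 1. $D(\Sigma(t))\subseteq D(B(t))$ for almost every $t\ge 0$. 2. For every $s\ge0$ and $f\in\mathcal E$, $U(t,s)f\in D(\Sigma(t))$ and $U(t,s)f\in D(B(t))$ for almost every $t\ge s$. 3. For every $s\ge 0$ and $f\in\mathcal E$, the (almost everywhere defined) map $t\in[s,\infty)\mapsto B(t)U(t,s)f\in\mathcal E$ is measurable. 4. For all $r\ge s\ge0$ and $f\in\mathcal E_+$, the functions $t\mapsto\|B(t)U(t,s)f\|$ and $t\mapsto\|\Sigma(t)U(t,s)f\|$ are integrable on $[s,r]$ and $$\int_s^r\|B(t)U(t,s)f\|\,\mathrm dt\le\int_s^r\|\Sigma(t)U(t,s)f\|\,\mathrm dt\le\|f\|-\|U(r,s)f\|.$$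 5. Consequently $(U(t,s))_{t\ge s\ge0}$ is a substochastic evolution family and $(B(t))_{t\ge0}$ an admissible family of positive perturbations of it, that is: $(t,s)\mapsto U(t,s)u$ is continuous on $\{t\ge s\ge0\}$ for every $u\in\mathcal E$; $U(t,s)=U(t,r)U(r,s)$ and $U(t,t)=I$ for $t\ge r\ge s\ge 0$; $\|U(t,s)\|\le Ce^{\beta(t-s)}$ for some constants $C,\beta>0$; $U(t,s)\mathcal E_+\subset\mathcal E_+$ and $\|U(t,s)u\|\le\|u\|$ for $u\in\mathcal E_+$ and $t\ge s\ge 0$; $B(t)u\in\mathcal E_+$ for $u\in D(B(t))\cap\mathcal E_+$ and $t\ge 0$; for all $u\in\mathcal E$ and $s\ge0$, $U(t,s)u\in D(B(t))$ for almost every $t\ge s$ and $t\mapsto B(t)U(t,s)u$ is measurable on $[s,\infty)$; and $\int_s^t\|B(r)U(r,s)u\|\,\mathrm dr\le\|u\|-\|U(t,s)u\|$ for all $t\ge s\ge0$ and $u\in\mathcal E_+$. -/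

import Mathlib

open MeasureTheory Set
open scoped NNReal ENNReal Topology

noncomputable section

/-! ### Evolution families and their unbounded perturbations -/

/-- Lebesgue measure on the half-line `[0, ∞)`. -/
def halfLine : Measure ℝ≥0 := (volume : Measure ℝ).comap ((↑) : ℝ≥0 → ℝ)

theorem map_val_halfLine : halfLine.map ((↑) : ℝ≥0 → ℝ) = volume.restrict (Ici (0 : ℝ)) := by
  have h : MeasurableEmbedding ((↑) : ℝ≥0 → ℝ) :=
    MeasurableEmbedding.subtype_coe (s := Ici (0 : ℝ)) measurableSet_Ici
  rw [halfLine, h.map_comap]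
  congr 1
  exact NNReal.range_coe

instance : SigmaFinite halfLine := by
  have : SigmaFinite (halfLine.map ((↑) : ℝ≥0 → ℝ)) := by
    rw [map_val_halfLine]; infer_instance
  exact SigmaFinite.of_map _ NNReal.continuous_coe.measurable.aemeasurable this

/-- The value `B u` of an unbounded operator, extended by `0` outside of its domain. It is used for
functions `t ↦ B(t) u(t)` for which `u(t)` lies in the domain of `B(t)` only for almost every `t`. -/
def LinearPMap.applyOrZero {X : Type*} [AddCommGroup X] [Module ℝ X] (B : X →ₗ.[ℝ] X) (u : X) : X :=
  open Classical in if h : u ∈ B.domain then B ⟨u, h⟩ else 0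

/-- A (strongly continuous, exponentially bounded) evolution family `(U(t,s))_{t ≥ s ≥ 0}`. The
values of `U t s` for `t < s` are irrelevant. -/
structure IsEvolutionFamily {X : Type*} [NormedAddCommGroup X] [NormedSpace ℝ X]
    (U : ℝ≥0 → ℝ≥0 → X →L[ℝ] X) : Prop where
  continuousOn : ∀ u : X, ContinuousOn (fun p : ℝ≥0 × ℝ≥0 => U p.1 p.2 u) {p | p.2 ≤ p.1}
  comp : ∀ t r s : ℝ≥0, s ≤ r → r ≤ t → U t s = (U t r).comp (U r s)
  refl : ∀ t : ℝ≥0, U t t = ContinuousLinearMap.id ℝ X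
  bound : ∃ C β : ℝ, 0 < C ∧ 0 < β ∧
    ∀ t s : ℝ≥0, s ≤ t → ‖U t s‖ ≤ C * Real.exp (β * ((t : ℝ) - s))

/-- The standing assumptions on a substochastic evolution family `U` in an ordered Banach space and
on a family `B` of unbounded positive perturbations. -/
structure SubstochasticPerturbation {X : Type*} [NormedAddCommGroup X] [NormedSpace ℝ X]
    [PartialOrder X] (U : ℝ≥0 → ℝ≥0 → X →L[ℝ] X) (B : ℝ≥0 → X →ₗ.[ℝ] X) : Prop where
  evolution : IsEvolutionFamily U
  nonneg : ∀ t s : ℝ≥0, s ≤ t → ∀ u : X, 0 ≤ u → 0 ≤ U t s u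
  norm_le : ∀ t s : ℝ≥0, s ≤ t → ∀ u : X, 0 ≤ u → ‖U t s u‖ ≤ ‖u‖
  perturbation_nonneg : ∀ (t : ℝ≥0) (u : (B t).domain), 0 ≤ (u : X) → 0 ≤ B t u
  mem_domain : ∀ (s : ℝ≥0) (u : X), ∀ᵐ t ∂halfLine, s ≤ t → U t s u ∈ (B t).domain
  measurable : ∀ (s : ℝ≥0) (u : X),
    AEStronglyMeasurable (fun t => (B t).applyOrZero (U t s u)) (halfLine.restrict (Ici s))
  dissipation : ∀ t s : ℝ≥0, s ≤ t → ∀ u : X, 0 ≤ u →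
    IntegrableOn (fun r => (B r).applyOrZero (U r s u)) (Icc s t) halfLine ∧
    ∫ r in Icc s t, ‖(B r).applyOrZero (U r s u)‖ ∂halfLine ≤ ‖u‖ - ‖U t s u‖

/-! ### The kinetic model -/

/-- The data of the linear kinetic equation: an open set `Ω ⊆ ℝ^d`, a `σ`-finite Borel measure `μ`
on `ℝ^d` whose support is the velocity space `V`, the collision frequency `Sig t v` and the
collision kernel `b t v v'`, both nonnegative and measurable, `Sig` being locally integrable in
time for almost every velocity, and `b` being sub-critical. -/
structure KineticModel (d : ℕ) where
  Ω : Set (EuclideanSpace ℝ (Fin d))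
  isOpen_Ω : IsOpen Ω
  μ : Measure (EuclideanSpace ℝ (Fin d))
  sigmaFinite_μ : SigmaFinite μ
  Sig : ℝ≥0 → μ.support → ℝ≥0
  measurable_Sig : Measurable (fun p : ℝ≥0 × μ.support => Sig p.1 p.2)
  locallyIntegrable_Sig : ∀ᵐ v ∂(μ.comap ((↑) : μ.support → EuclideanSpace ℝ (Fin d))),
    LocallyIntegrable (fun t => (Sig t v : ℝ)) halfLine
  b : ℝ≥0 → μ.support → μ.support → ℝ≥0
  measurable_b : Measurable (fun p : ℝ≥0 × μ.support × μ.support => b p.1 p.2.1 p.2.2)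
  subcritical :
    ∀ᵐ p ∂(halfLine.prod (μ.comap ((↑) : μ.support → EuclideanSpace ℝ (Fin d)))),
      ∫⁻ v, (b p.1 v p.2 : ℝ≥0∞) ∂(μ.comap ((↑) : μ.support → EuclideanSpace ℝ (Fin d)))
        ≤ (Sig p.1 p.2 : ℝ≥0∞)

namespace KineticModel

variable {d : ℕ} (M : KineticModel d)

/-- The velocity space `V`, the support of `μ`. -/
abbrev V : Type := M.μ.support

/-- The measure `μ` on `V`. -/
def velMeasure : Measure M.V := M.μ.comap ((↑) : M.V → EuclideanSpace ℝ (Fin d))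

instance : SigmaFinite M.velMeasure := by
  have h : MeasurableEmbedding ((↑) : M.V → EuclideanSpace ℝ (Fin d)) :=
    MeasurableEmbedding.subtype_coe M.μ.isClosed_support.measurableSet
  have := M.sigmaFinite_μ
  have h2 : SigmaFinite (M.velMeasure.map ((↑) : M.V → EuclideanSpace ℝ (Fin d))) := by
    rw [velMeasure, h.map_comap]; infer_instance
  exact SigmaFinite.of_map _ h.measurable.aemeasurable h2

/-- The measure `dx ⊗ dμ(v)` on the phase space `Λ = Ω × V`. -/
def phaseMeasure : Measure (EuclideanSpace ℝ (Fin d) × M.V) :=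
  (volume.restrict M.Ω).prod M.velMeasure

instance : SigmaFinite M.phaseMeasure := by
  unfold phaseMeasure; infer_instance

/-- The state space `L¹(Ω × V, dx ⊗ dμ(v))`. -/
abbrev State : Type := Lp ℝ 1 M.phaseMeasure

/-- `τ(x, v) = inf {t > 0 : x - t v ∉ Ω} ∈ [0, ∞]`. -/
def exitTime (x : EuclideanSpace ℝ (Fin d)) (v : M.V) : ℝ≥0∞ :=
  sInf (ENNReal.ofReal '' {t : ℝ | 0 < t ∧ x - t • (v : EuclideanSpace ℝ (Fin d)) ∉ M.Ω})

/-- The set of the `(x, v) ∈ Ω × V` with `δ < τ(x, v)`. -/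
def reach (δ : ℝ≥0) : Set (EuclideanSpace ℝ (Fin d) × M.V) :=
  {p | p.1 ∈ M.Ω ∧ (δ : ℝ≥0∞) < M.exitTime p.1 p.2}

/-- The absorption factor `exp (- ∫_s^t Sig(r, v) dr)`. -/
def absorption (t s : ℝ≥0) (v : M.V) : ℝ :=
  Real.exp (-∫ r in Icc s t, (M.Sig r v : ℝ) ∂halfLine)

/-- For `t ≥ s`, the function
`(x, v) ↦ exp (- ∫_s^t Sig(r, v) dr) φ(x - (t - s) v, v) 1_{t - s < τ(x, v)}`. -/
def transportFun (t s : ℝ≥0) (φ : EuclideanSpace ℝ (Fin d) × M.V → ℝ) :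
    EuclideanSpace ℝ (Fin d) × M.V → ℝ :=
  (M.reach (t - s)).indicator fun p =>
    M.absorption t s p.2 *
      φ (p.1 - ((t - s : ℝ≥0) : ℝ) • (p.2 : EuclideanSpace ℝ (Fin d)), p.2)

theorem mem_reach_iff (δ : ℝ≥0) (p : EuclideanSpace ℝ (Fin d) × M.V) :
    p ∈ M.reach δ ↔ ∀ r ∈ Icc (0 : ℝ) δ, p.1 - r • (p.2 : EuclideanSpace ℝ (Fin d)) ∈ M.Ω := by
  constructor
  · rintro ⟨h1, h2⟩ r ⟨hr0, hr⟩
    rcases hr0.eq_or_lt with rfl | hr0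
    · simpa using h1
    by_contra hc
    have h3 : M.exitTime p.1 p.2 ≤ ENNReal.ofReal r := sInf_le ⟨r, ⟨hr0, hc⟩, rfl⟩
    have h4 : ENNReal.ofReal r ≤ (δ : ℝ≥0∞) := by
      rw [← ENNReal.ofReal_coe_nnreal]; exact ENNReal.ofReal_le_ofReal hr
    exact absurd h2 (not_lt.2 (h3.trans h4))
  · intro h
    refine ⟨by simpa using h 0 ⟨le_rfl, δ.2⟩, ?_⟩
    have hc : Continuous fun r : ℝ => p.1 - r • (p.2 : EuclideanSpace ℝ (Fin d)) := by fun_prop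
    have ho := M.isOpen_Ω.preimage hc
    obtain ⟨ε, hε, hb⟩ := Metric.isOpen_iff.1 ho (δ : ℝ) (h δ ⟨δ.2, le_rfl⟩)
    have hlt : (δ : ℝ≥0∞) < ENNReal.ofReal (δ + ε) := by
      rw [← ENNReal.ofReal_coe_nnreal]
      exact (ENNReal.ofReal_lt_ofReal_iff (by positivity)).2 (by linarith)
    refine hlt.trans_le (le_sInf ?_)
    rintro _ ⟨t, ⟨ht0, ht⟩, rfl⟩
    refine ENNReal.ofReal_le_ofReal (not_lt.1 fun hlt => ht ?_)
    by_cases htδ : t ≤ δ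
    · exact h t ⟨ht0.le, htδ⟩
    · refine hb ?_
      rw [Metric.mem_ball, Real.dist_eq, abs_of_pos (by linarith)]
      linarith

theorem isOpen_reach (δ : ℝ≥0) : IsOpen (M.reach δ) := by
  have h : M.reach δ = {p | ∀ r ∈ Icc (0 : ℝ) δ,
      p.1 - r • (p.2 : EuclideanSpace ℝ (Fin d)) ∈ M.Ω} := by
    ext p; exact M.mem_reach_iff δ p
  rw [h, isOpen_iff_mem_nhds]
  intro p hp
  refine (isCompact_Icc : IsCompact (Icc (0 : ℝ) δ)).eventually_forall_of_forall_eventually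
    (P := fun (q : EuclideanSpace ℝ (Fin d) × M.V) (r : ℝ) => q.1 - r • (q.2 : EuclideanSpace ℝ (Fin d)) ∈ M.Ω) ?_
  intro r hr
  have hc : Continuous fun z : (EuclideanSpace ℝ (Fin d) × M.V) × ℝ =>
      z.1.1 - z.2 • (z.1.2 : EuclideanSpace ℝ (Fin d)) := by fun_prop
  exact (M.isOpen_Ω.preimage hc).mem_nhds (hp r hr)

theorem measurable_absorption (t s : ℝ≥0) : Measurable (M.absorption t s) := by
  have h : StronglyMeasurable (Function.uncurry fun (v : M.V) (r : ℝ≥0) => (M.Sig r v : ℝ)) :=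
    ((M.measurable_Sig.comp measurable_swap).coe_nnreal_real).stronglyMeasurable
  exact Real.measurable_exp.comp
    ((h.integral_prod_right (ν := halfLine.restrict (Icc s t))).measurable.neg)

theorem absorption_nonneg (t s : ℝ≥0) (v : M.V) : 0 ≤ M.absorption t s v := (Real.exp_pos _).le

theorem absorption_le_one (t s : ℝ≥0) (v : M.V) : M.absorption t s v ≤ 1 := by
  refine Real.exp_le_one_iff.2 (neg_nonpos.2 (integral_nonneg fun r => ?_))
  exact (M.Sig r v).2

/-- The backward shift along the characteristics preserves `dx ⊗ dμ(v)` on `ℝ^d × V`. -/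
theorem measurePreserving_shift (δ : ℝ) :
    MeasurePreserving
      (fun p : EuclideanSpace ℝ (Fin d) × M.V =>
        (p.1 - δ • (p.2 : EuclideanSpace ℝ (Fin d)), p.2))
      (volume.prod M.velMeasure) (volume.prod M.velMeasure) := by
  have h := (MeasurePreserving.id M.velMeasure).skew_product
    (μc := (volume : Measure (EuclideanSpace ℝ (Fin d)))) (μd := volume)
    (g := fun v x => x - δ • (v : EuclideanSpace ℝ (Fin d)))
    (by
      refine Continuous.measurable ?_
      unfold Function.uncurry
      fun_prop)
    (.of_forall fun v => (measurePreserving_sub_right volume _).map_eq)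
  exact (Measure.measurePreserving_swap.comp h).comp Measure.measurePreserving_swap

theorem phaseMeasure_eq :
    M.phaseMeasure = (volume.prod M.velMeasure).restrict (M.Ω ×ˢ univ) := by
  rw [phaseMeasure, ← Measure.prod_restrict, Measure.restrict_univ]

theorem measurePreserving_shift_preimage (δ : ℝ) :
    MeasurePreserving
      (fun p : EuclideanSpace ℝ (Fin d) × M.V =>
        (p.1 - δ • (p.2 : EuclideanSpace ℝ (Fin d)), p.2))
      ((volume.prod M.velMeasure).restrict
        ((fun p : EuclideanSpace ℝ (Fin d) × M.V =>
          (p.1 - δ • (p.2 : EuclideanSpace ℝ (Fin d)), p.2)) ⁻¹' (M.Ω ×ˢ univ)))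
      M.phaseMeasure := by
  rw [phaseMeasure_eq]
  exact (M.measurePreserving_shift δ).restrict_preimage
    (M.isOpen_Ω.measurableSet.prod MeasurableSet.univ)

theorem restrict_reach_le (δ : ℝ≥0) :
    M.phaseMeasure.restrict (M.reach δ) ≤ (volume.prod M.velMeasure).restrict
        ((fun p : EuclideanSpace ℝ (Fin d) × M.V =>
          (p.1 - (δ : ℝ) • (p.2 : EuclideanSpace ℝ (Fin d)), p.2)) ⁻¹' (M.Ω ×ˢ univ)) := by
  rw [phaseMeasure_eq, Measure.restrict_restrict (M.isOpen_reach δ).measurableSet]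
  refine Measure.restrict_mono ?_ le_rfl
  rintro p ⟨hp, -⟩
  exact ⟨(M.mem_reach_iff δ p).1 hp δ ⟨δ.2, le_rfl⟩, trivial⟩

theorem quasiMeasurePreserving_shift (δ : ℝ≥0) :
    Measure.QuasiMeasurePreserving
      (fun p : EuclideanSpace ℝ (Fin d) × M.V =>
        (p.1 - (δ : ℝ) • (p.2 : EuclideanSpace ℝ (Fin d)), p.2))
      (M.phaseMeasure.restrict (M.reach δ)) M.phaseMeasure :=
  (M.measurePreserving_shift_preimage δ).quasiMeasurePreserving.mono_left
    (M.restrict_reach_le δ).absolutelyContinuous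

theorem transportFun_congr (t s : ℝ≥0) {φ ψ : EuclideanSpace ℝ (Fin d) × M.V → ℝ}
    (h : φ =ᵐ[M.phaseMeasure] ψ) :
    M.transportFun t s φ =ᵐ[M.phaseMeasure] M.transportFun t s ψ := by
  have h1 := (M.quasiMeasurePreserving_shift (t - s)).ae_eq_comp h
  rw [Filter.EventuallyEq, ae_restrict_iff' (M.isOpen_reach _).measurableSet] at h1
  filter_upwards [h1] with p hp
  by_cases hm : p ∈ M.reach (t - s)
  · simp only [transportFun, indicator_of_mem hm]
    congr 1
    exact hp hm
  · simp only [transportFun, indicator_of_notMem hm]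

theorem eLpNorm_transportFun_le (t s : ℝ≥0) {φ : EuclideanSpace ℝ (Fin d) × M.V → ℝ}
    (h : AEStronglyMeasurable φ M.phaseMeasure) :
    eLpNorm (M.transportFun t s φ) 1 M.phaseMeasure ≤ eLpNorm φ 1 M.phaseMeasure := by
  have hA := (M.isOpen_reach (t - s)).measurableSet
  have hT := M.measurePreserving_shift_preimage ((t - s : ℝ≥0) : ℝ)
  have hφ : ∫⁻ p, ‖φ p‖ₑ ∂M.phaseMeasure = _ :=
    (hT.map_eq ▸ lintegral_map' (f := fun p => ‖φ p‖ₑ) (by rw [hT.map_eq]; exact h.enorm)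
      hT.measurable.aemeasurable :)
  rw [transportFun, eLpNorm_indicator_eq_eLpNorm_restrict hA, eLpNorm_one_eq_lintegral_enorm,
    eLpNorm_one_eq_lintegral_enorm, hφ]
  refine lintegral_mono' (M.restrict_reach_le (t - s)) fun p => ?_
  rw [enorm_mul]
  refine (mul_le_mul_left ?_ _).trans_eq (one_mul _)
  rw [Real.enorm_of_nonneg (M.absorption_nonneg t s p.2)]
  exact ENNReal.ofReal_le_one.2 (M.absorption_le_one t s p.2)

theorem memLp_transportFun (t s : ℝ≥0) {φ : EuclideanSpace ℝ (Fin d) × M.V → ℝ}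
    (h : MemLp φ 1 M.phaseMeasure) : MemLp (M.transportFun t s φ) 1 M.phaseMeasure := by
  refine ⟨?_, (M.eLpNorm_transportFun_le t s h.1).trans_lt h.2⟩
  rw [transportFun, aestronglyMeasurable_indicator_iff (M.isOpen_reach _).measurableSet]
  exact ((M.measurable_absorption t s).comp measurable_snd).aestronglyMeasurable.mul
    (h.1.comp_quasiMeasurePreserving (M.quasiMeasurePreserving_shift (t - s)))

/-- The evolution family `U(t, s)` of free transport with absorption. -/
def U (t s : ℝ≥0) : M.State →L[ℝ] M.State :=
  LinearMap.mkContinuous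
    { toFun := fun φ => (M.memLp_transportFun t s (Lp.memLp φ)).toLp
      map_add' := fun φ ψ => by
        rw [← MemLp.toLp_add, MemLp.toLp_eq_toLp_iff]
        refine (M.transportFun_congr t s (Lp.coeFn_add φ ψ)).trans (.of_forall fun p => ?_)
        by_cases hm : p ∈ M.reach (t - s) <;> simp [transportFun, hm, mul_add]
      map_smul' := fun c φ => by
        rw [RingHom.id_apply, ← MemLp.toLp_const_smul, MemLp.toLp_eq_toLp_iff]
        refine (M.transportFun_congr t s (Lp.coeFn_smul c φ)).trans (.of_forall fun p => ?_)
        by_cases hm : p ∈ M.reach (t - s) <;> simp [transportFun, hm, mul_left_comm] }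
    1 (fun φ => by
      rw [one_mul, LinearMap.coe_mk, AddHom.coe_mk, Lp.norm_toLp, Lp.norm_def]
      exact ENNReal.toReal_mono (Lp.eLpNorm_ne_top φ)
        (M.eLpNorm_transportFun_le t s (Lp.aestronglyMeasurable φ)))

/-- The space of the `φ ∈ L¹(Ω × V)` with `∫ w(v) |φ(x, v)| dx dμ(v) < ∞`. -/
def weightedDomain (w : M.V → ℝ≥0∞) (hw : Measurable w) : Submodule ℝ M.State where
  carrier := {φ | ∫⁻ p, w p.2 * ‖φ p‖ₑ ∂M.phaseMeasure < ∞}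
  zero_mem' := by
    have h : ∫⁻ p, w p.2 * ‖(0 : M.State) p‖ₑ ∂M.phaseMeasure = 0 := by
      rw [lintegral_congr_ae (g := fun _ => 0), lintegral_zero]
      filter_upwards [Lp.coeFn_zero ℝ 1 M.phaseMeasure] with p hp
      rw [hp, Pi.zero_apply, enorm_zero, mul_zero]
    exact h.trans_lt ENNReal.zero_lt_top
  add_mem' := by
    intro φ ψ hφ hψ
    refine lt_of_le_of_lt ?_ (ENNReal.add_lt_top.2 ⟨hφ, hψ⟩)
    have hm : AEMeasurable (fun p => w p.2 * ‖φ p‖ₑ) M.phaseMeasure :=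
      (hw.comp measurable_snd).aemeasurable.mul (Lp.aestronglyMeasurable φ).enorm
    rw [← lintegral_add_left' hm]
    refine lintegral_mono_ae ?_
    filter_upwards [Lp.coeFn_add φ ψ] with p hp
    rw [hp, Pi.add_apply, ← mul_add]
    gcongr
    exact enorm_add_le _ _
  smul_mem' := by
    intro c φ hφ
    have h : ∫⁻ p, w p.2 * ‖(c • φ : M.State) p‖ₑ ∂M.phaseMeasure
        = ‖c‖ₑ * ∫⁻ p, w p.2 * ‖φ p‖ₑ ∂M.phaseMeasure := by
      rw [← lintegral_const_mul' _ _ enorm_ne_top]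
      refine lintegral_congr_ae ?_
      filter_upwards [Lp.coeFn_smul c φ] with p hp
      rw [hp, Pi.smul_apply, smul_eq_mul, enorm_mul, mul_left_comm]
    refine h.trans_lt ?_
    exact ENNReal.mul_lt_top enorm_lt_top hφ

theorem measurable_Sig_right (t : ℝ≥0) : Measurable (M.Sig t) :=
  M.measurable_Sig.comp measurable_prodMk_left

theorem memLp_sig_mul (t : ℝ≥0) {φ : M.State}
    (h : ∫⁻ p, (M.Sig t p.2 : ℝ≥0∞) * ‖φ p‖ₑ ∂M.phaseMeasure < ∞) :
    MemLp (fun p => (M.Sig t p.2 : ℝ) * φ p) 1 M.phaseMeasure := by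
  refine ⟨((M.measurable_Sig_right t).comp measurable_snd).coe_nnreal_real.aestronglyMeasurable.mul
    (Lp.aestronglyMeasurable φ), ?_⟩
  rw [eLpNorm_one_eq_lintegral_enorm]
  refine lt_of_eq_of_lt (lintegral_congr fun p => ?_) h
  rw [enorm_mul]
  congr 1
  exact NNReal.enorm_eq _

/-- The multiplication operator `Σ(t)` by `Sig(t, v)`, with domain `L¹(Ω × V, Sig(t, v) dx dμ(v))`
(inside of `L¹(Ω × V)`). -/
def SigOp (t : ℝ≥0) : M.State →ₗ.[ℝ] M.State where
  domain := M.weightedDomain (fun v => (M.Sig t v : ℝ≥0∞))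
    (M.measurable_Sig_right t).coe_nnreal_ennreal
  toFun :=
    { toFun := fun φ => (M.memLp_sig_mul t φ.2).toLp
      map_add' := fun φ ψ => by
        rw [← MemLp.toLp_add, MemLp.toLp_eq_toLp_iff]
        filter_upwards [Lp.coeFn_add (φ : M.State) ψ] with p hp
        exact (congrArg _ hp).trans (mul_add _ _ _)
      map_smul' := fun c φ => by
        rw [RingHom.id_apply, ← MemLp.toLp_const_smul, MemLp.toLp_eq_toLp_iff]
        filter_upwards [Lp.coeFn_smul c (φ : M.State)] with p hp
        exact (congrArg _ hp).trans (mul_left_comm _ _ _) }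

/-- `σ(t, v) = ∫_V b(t, v', v) dμ(v') ∈ [0, ∞]`. -/
def sigma (t : ℝ≥0) (v : M.V) : ℝ≥0∞ := ∫⁻ v', (M.b t v' v : ℝ≥0∞) ∂M.velMeasure

theorem measurable_b_right (t : ℝ≥0) : Measurable (fun p : M.V × M.V => M.b t p.1 p.2) :=
  M.measurable_b.comp measurable_prodMk_left

theorem measurable_sigma (t : ℝ≥0) : Measurable (M.sigma t) :=
  (M.measurable_b_right t).coe_nnreal_ennreal.lintegral_prod_left'

/-- The function `(x, v) ↦ ∫_V b(t, v, v') φ(x, v') dμ(v')`. -/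
def collisionFun (t : ℝ≥0) (φ : EuclideanSpace ℝ (Fin d) × M.V → ℝ) :
    EuclideanSpace ℝ (Fin d) × M.V → ℝ :=
  fun p => ∫ v', (M.b t p.2 v' : ℝ) * φ (p.1, v') ∂M.velMeasure

theorem quasiMeasurePreserving_replace :
    Measure.QuasiMeasurePreserving
      (fun q : (EuclideanSpace ℝ (Fin d) × M.V) × M.V => (q.1.1, q.2))
      (M.phaseMeasure.prod M.velMeasure) M.phaseMeasure :=
  MeasureTheory.QuasiMeasurePreserving.prodMap
    Measure.quasiMeasurePreserving_fst (Measure.QuasiMeasurePreserving.id _)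

theorem aestronglyMeasurable_collision (t : ℝ≥0) {φ : EuclideanSpace ℝ (Fin d) × M.V → ℝ}
    (hφ : AEStronglyMeasurable φ M.phaseMeasure) :
    AEStronglyMeasurable
      (fun q : (EuclideanSpace ℝ (Fin d) × M.V) × M.V => (M.b t q.1.2 q.2 : ℝ) * φ (q.1.1, q.2))
      (M.phaseMeasure.prod M.velMeasure) :=
  ((M.measurable_b_right t).comp
    ((measurable_snd.comp measurable_fst).prodMk
      measurable_snd)).coe_nnreal_real.aestronglyMeasurable.mul
    (hφ.comp_quasiMeasurePreserving M.quasiMeasurePreserving_replace)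

theorem lintegral_collision (t : ℝ≥0) {φ : EuclideanSpace ℝ (Fin d) × M.V → ℝ}
    (hφ : AEStronglyMeasurable φ M.phaseMeasure) :
    ∫⁻ p, ∫⁻ v', ‖(M.b t p.2 v' : ℝ) * φ (p.1, v')‖ₑ ∂M.velMeasure ∂M.phaseMeasure
      = ∫⁻ p, M.sigma t p.2 * ‖φ p‖ₑ ∂M.phaseMeasure := by
  have h1 : AEMeasurable
      (fun p => ∫⁻ v', ‖(M.b t p.2 v' : ℝ) * φ (p.1, v')‖ₑ ∂M.velMeasure) M.phaseMeasure :=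
    (M.aestronglyMeasurable_collision t hφ).enorm.lintegral_prod_right'
  have h2 : AEMeasurable (fun p => M.sigma t p.2 * ‖φ p‖ₑ) M.phaseMeasure :=
    ((M.measurable_sigma t).comp measurable_snd).aemeasurable.mul hφ.enorm
  rw [phaseMeasure] at h1 h2 hφ ⊢
  rw [lintegral_prod _ h1, lintegral_prod _ h2]
  refine lintegral_congr_ae ?_
  filter_upwards [hφ.prodMk_left] with x hx
  rw [lintegral_lintegral_swap]
  · refine lintegral_congr fun v' => ?_
    have hm : Measurable fun v => (M.b t v v' : ℝ≥0∞) :=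
      ((M.measurable_b_right t).comp measurable_prodMk_right).coe_nnreal_ennreal
    rw [sigma, ← lintegral_mul_const _ hm]
    refine lintegral_congr fun v => ?_
    rw [enorm_mul]
    congr 1
    exact NNReal.enorm_eq _
  · exact ((M.measurable_b_right t).coe_nnreal_real.aestronglyMeasurable.mul
      (hx.comp_quasiMeasurePreserving Measure.quasiMeasurePreserving_snd)).enorm

theorem ae_integrable_collision (t : ℝ≥0) {φ : M.State}
    (h : ∫⁻ p, M.sigma t p.2 * ‖φ p‖ₑ ∂M.phaseMeasure < ∞) :
    ∀ᵐ p ∂M.phaseMeasure,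
      Integrable (fun v' => (M.b t p.2 v' : ℝ) * φ (p.1, v')) M.velMeasure := by
  rw [← M.lintegral_collision t (Lp.aestronglyMeasurable φ)] at h
  have h1 := M.aestronglyMeasurable_collision t (Lp.aestronglyMeasurable φ)
  filter_upwards [ae_lt_top' h1.enorm.lintegral_prod_right' h.ne, h1.prodMk_left] with p hp hm
  exact ⟨hm, hp⟩

theorem memLp_collisionFun (t : ℝ≥0) {φ : M.State}
    (h : ∫⁻ p, M.sigma t p.2 * ‖φ p‖ₑ ∂M.phaseMeasure < ∞) :
    MemLp (M.collisionFun t φ) 1 M.phaseMeasure := by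
  refine ⟨(M.aestronglyMeasurable_collision t (Lp.aestronglyMeasurable φ)).integral_prod_right', ?_⟩
  rw [eLpNorm_one_eq_lintegral_enorm]
  rw [← M.lintegral_collision t (Lp.aestronglyMeasurable φ)] at h
  exact (lintegral_mono fun p => enorm_integral_le_lintegral_enorm _).trans_lt h

theorem collisionFun_congr (t : ℝ≥0) {φ ψ : EuclideanSpace ℝ (Fin d) × M.V → ℝ}
    (h : φ =ᵐ[M.phaseMeasure] ψ) :
    M.collisionFun t φ =ᵐ[M.phaseMeasure] M.collisionFun t ψ := by
  filter_upwards [Measure.ae_ae_of_ae_prod (M.quasiMeasurePreserving_replace.ae h)] with p hp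
  refine integral_congr_ae ?_
  filter_upwards [hp] with v' hv'
  rw [hv']

/-- The collision operator `B(t)`, `[B(t) φ](x, v) = ∫_V b(t, v, v') φ(x, v') dμ(v')`, on the domain
of the `φ ∈ L¹(Ω × V)` with `∫ σ(t, v) |φ(x, v)| dx dμ(v) < ∞`. -/
def B (t : ℝ≥0) : M.State →ₗ.[ℝ] M.State where
  domain := M.weightedDomain (M.sigma t) (M.measurable_sigma t)
  toFun :=
    { toFun := fun φ => (M.memLp_collisionFun t φ.2).toLp
      map_add' := fun φ ψ => by
        rw [← MemLp.toLp_add, MemLp.toLp_eq_toLp_iff]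
        refine (M.collisionFun_congr t (Lp.coeFn_add (φ : M.State) ψ)).trans ?_
        filter_upwards [M.ae_integrable_collision t φ.2, M.ae_integrable_collision t ψ.2]
          with p h1 h2
        simp only [collisionFun, Pi.add_apply, mul_add]
        exact integral_add h1 h2
      map_smul' := fun c φ => by
        rw [RingHom.id_apply, ← MemLp.toLp_const_smul, MemLp.toLp_eq_toLp_iff]
        refine (M.collisionFun_congr t (Lp.coeFn_smul c (φ : M.State))).trans
          (.of_forall fun p => ?_)
        simp only [collisionFun, Pi.smul_apply, smul_eq_mul, mul_left_comm _ c]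
        exact integral_const_mul c _ }

end KineticModel

end

/-! ### Integration on the half-line -/

/-! Everything rests on one balance along characteristics. For a velocity `v` with `Sig · v` locally
integrable, put `A(t) = ∫_s^t Sig(q, v) dq`. The derivative of `-exp(-A)` is `Sig · exp(-A)` almost
everywhere, so the fraction of the mass absorbed on `[s, r]` plus the surviving fraction
`exp(-A(r))` is at most one (`lintegral_mul_exp_add_exp_le_one`). The shift `x ↦ x - (t - s)v`
preserves `dx ⊗ dμ` and leaves functions of `v` alone, and leaving `Ω` only loses mass. Tonelli then
gives `∫_s^r ‖Σ(t)U(t,s)f‖ dt + ‖U(r,s)f‖ ≤ ‖f‖` as an inequality in `[0, ∞]`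
(`lintegral_Sig_mul_U_add_le`). Its finiteness puts `U(t,s)f` into the domain of `Σ(t)` for almost
every `t`. Sub-criticality and Tonelli in `(v, v')` carry both the domains and the estimates over to
`B(t)`.

Two further points need an argument. Measurability of `t ↦ B(t)U(t,s)f` in `L¹` follows from a
jointly measurable representative and the separability of `L¹`
(`stronglyMeasurable_Lp_one_of_uncurry`). Strong continuity is proved one velocity at a time: free
transport is continuous on continuous compactly supported functions vanishing off `Ω`
(`continuous_stream_left`), hence by density and contractivity on all of `L¹(Ω)`. The absorption
factor is continuous in `(t, s)`, and dominated convergence in `v` concludes (`continuousOn_U`). The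
algebraic laws reduce to splitting the segment traced backwards and the integral of `Sig`. -/

theorem measurableEmbedding_val_nnreal : MeasurableEmbedding ((↑) : ℝ≥0 → ℝ) :=
  MeasurableEmbedding.subtype_coe (s := Ici (0 : ℝ)) measurableSet_Ici

theorem halfLine_singleton (t : ℝ≥0) : halfLine {t} = 0 := by
  rw [halfLine, measurableEmbedding_val_nnreal.comap_apply, image_singleton, measure_singleton]

theorem map_val_halfLine_restrict_Icc (s t : ℝ≥0) :
    (halfLine.restrict (Icc s t)).map ((↑) : ℝ≥0 → ℝ) = volume.restrict (Icc (s : ℝ) t) := by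
  have h : Icc s t = ((↑) : ℝ≥0 → ℝ) ⁻¹' Icc (s : ℝ) t := by ext; simp
  rw [h, ← measurableEmbedding_val_nnreal.restrict_map, map_val_halfLine,
    Measure.restrict_restrict measurableSet_Icc,
    inter_eq_left.2 (show Icc (s : ℝ) t ⊆ Ici 0 from fun x hx => s.2.trans hx.1)]

/-- The extension by zero of a function on the half-line. -/
noncomputable def extendZero (g : ℝ≥0 → ℝ≥0) : ℝ → ℝ :=
  (Ici 0).indicator fun x => (g x.toNNReal : ℝ)

theorem extendZero_coe (g : ℝ≥0 → ℝ≥0) (t : ℝ≥0) : extendZero g t = g t := by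
  rw [extendZero, indicator_of_mem (by exact t.2), Real.toNNReal_coe]

theorem extendZero_nonneg (g : ℝ≥0 → ℝ≥0) (x : ℝ) : 0 ≤ extendZero g x :=
  indicator_nonneg (fun _ _ => NNReal.coe_nonneg _) _

/-- Only the compact piece `[0, max a b]` matters, and there local integrability on the half-line
applies. This opens the way to the theory of primitives on `ℝ`. -/
theorem intervalIntegrable_extendZero {g : ℝ≥0 → ℝ≥0}
    (hg : LocallyIntegrable (fun t => (g t : ℝ)) halfLine) (a b : ℝ) :
    IntervalIntegrable (extendZero g) volume a b := by
  have h1 : IntegrableOn (fun t => (g t : ℝ)) (Icc 0 (max a b).toNNReal) halfLine :=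
    hg.integrableOn_isCompact isCompact_Icc
  have h2 : IntegrableOn (extendZero g) (Icc 0 ((max a b).toNNReal : ℝ)) volume := by
    rw [IntegrableOn, ← NNReal.coe_zero, ← map_val_halfLine_restrict_Icc,
      measurableEmbedding_val_nnreal.integrable_map_iff]
    exact h1.congr (.of_forall fun t => (extendZero_coe g t).symm)
  rw [intervalIntegrable_iff, extendZero, integrableOn_indicator_iff measurableSet_Ici]
  rw [extendZero] at h2
  refine ((integrableOn_congr_fun (fun x hx => ?_) measurableSet_Icc).1 h2).mono_set ?_
  · exact indicator_of_mem (by exact hx.1) _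
  · rintro x ⟨h0, hx⟩
    exact ⟨h0, hx.2.trans (Real.le_coe_toNNReal _)⟩

theorem intervalIntegral_extendZero (g : ℝ≥0 → ℝ≥0) {s t : ℝ≥0} (h : s ≤ t) :
    ∫ x in (s : ℝ)..t, extendZero g x = ∫ r in Icc s t, (g r : ℝ) ∂halfLine := by
  rw [intervalIntegral.integral_of_le (by exact_mod_cast h), ← integral_Icc_eq_integral_Ioc,
    ← map_val_halfLine_restrict_Icc, measurableEmbedding_val_nnreal.integral_map]
  simp only [extendZero_coe]

theorem setIntegral_Icc_halfLine_add {g : ℝ≥0 → ℝ≥0}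
    (hg : LocallyIntegrable (fun t => (g t : ℝ)) halfLine) {s r t : ℝ≥0} (hsr : s ≤ r)
    (hrt : r ≤ t) :
    ∫ q in Icc s t, (g q : ℝ) ∂halfLine
      = ∫ q in Icc s r, (g q : ℝ) ∂halfLine + ∫ q in Icc r t, (g q : ℝ) ∂halfLine := by
  rw [← intervalIntegral_extendZero g hsr, ← intervalIntegral_extendZero g hrt,
    ← intervalIntegral_extendZero g (hsr.trans hrt),
    intervalIntegral.integral_add_adjacent_intervals] <;>
  exact intervalIntegrable_extendZero hg _ _

theorem continuousOn_setIntegral_Icc_halfLine {g : ℝ≥0 → ℝ≥0}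
    (hg : LocallyIntegrable (fun t => (g t : ℝ)) halfLine) :
    ContinuousOn (fun p : ℝ≥0 × ℝ≥0 => ∫ r in Icc p.2 p.1, (g r : ℝ) ∂halfLine)
      {p | p.2 ≤ p.1} := by
  have hint := intervalIntegrable_extendZero hg
  have hc : Continuous fun x : ℝ => ∫ y in (0 : ℝ)..x, extendZero g y :=
    intervalIntegral.continuous_primitive hint 0
  have h : Continuous fun p : ℝ≥0 × ℝ≥0 =>
      (∫ y in (0 : ℝ)..p.1, extendZero g y) - ∫ y in (0 : ℝ)..p.2, extendZero g y :=
    (hc.comp (NNReal.continuous_coe.comp continuous_fst)).sub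
      (hc.comp (NNReal.continuous_coe.comp continuous_snd))
  refine h.continuousOn.congr fun p hp => ?_
  rw [← intervalIntegral_extendZero g hp]
  exact (intervalIntegral.integral_interval_sub_left (hint _ _) (hint _ _)).symm

/-- The mass absorbed along a characteristic and the mass which survives add up to at most one. -/
theorem lintegral_mul_exp_add_exp_le_one {g : ℝ≥0 → ℝ≥0}
    (hg : LocallyIntegrable (fun t => (g t : ℝ)) halfLine) {s r : ℝ≥0} (hsr : s ≤ r) :
    ∫⁻ t in Icc s r, (g t : ℝ≥0∞) *
        ENNReal.ofReal (Real.exp (-∫ q in Icc s t, (g q : ℝ) ∂halfLine)) ∂halfLine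
      + ENNReal.ofReal (Real.exp (-∫ q in Icc s r, (g q : ℝ) ∂halfLine)) ≤ 1 := by
  have hint := intervalIntegrable_extendZero hg
  have hle : (s : ℝ) ≤ r := by exact_mod_cast hsr
  set A : ℝ → ℝ := fun x => ∫ y in (s : ℝ)..x, extendZero g y with hA
  -- Since only an inequality is wanted, monotonicity replaces absolute continuity: the integral of
  -- the a.e. derivative of a monotone function is at most its increment.
  have hmono : Monotone fun x => -Real.exp (-A x) := by
    intro x y hxy
    have h1 : A x ≤ A y := by
      have h2 := intervalIntegral.integral_interval_sub_left (hint s y) (hint s x)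
      have h3 := intervalIntegral.integral_nonneg (μ := volume) hxy
        fun u _ => extendZero_nonneg g u
      exact sub_nonneg.1 (h2.symm ▸ h3 :)
    exact neg_le_neg (Real.exp_le_exp.2 (neg_le_neg h1))
  have hderiv : ∀ᵐ x ∂volume.restrict (Icc (s : ℝ) r),
      deriv (fun x => -Real.exp (-A x)) x = extendZero g x * Real.exp (-A x) := by
    rw [ae_restrict_iff' measurableSet_Icc]
    filter_upwards [(hint s r).ae_hasDerivAt_integral] with x hx hxm
    rw [uIcc_of_le hle] at hx
    have h1 := (hx hxm s (left_mem_Icc.2 hle)).neg.exp.neg.deriv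
    refine h1.trans ?_
    rw [mul_neg, neg_neg, mul_comm]
    rfl
  have hI := (hmono.monotoneOn (uIcc (s : ℝ) r)).intervalIntegrable_deriv
  -- This becomes `0 ≤ ∫ deriv ≤ 1 - exp(-A r)` once `A s = 0` is inserted.
  have hV := (hmono.monotoneOn (uIcc (s : ℝ) r)).intervalIntegral_deriv_mem_uIcc
  have hAs : A s = 0 := intervalIntegral.integral_same
  have hAr : A r = ∫ q in Icc s r, (g q : ℝ) ∂halfLine := intervalIntegral_extendZero g hsr
  rw [uIcc_of_le (sub_nonneg.2 (hmono hle)), intervalIntegral.integral_of_le hle,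
    ← integral_Icc_eq_integral_Ioc] at hV
  beta_reduce at hV
  rw [hAs] at hV
  rw [intervalIntegrable_iff_integrableOn_Icc_of_le hle] at hI
  have h0 : 0 ≤ᵐ[volume.restrict (Icc (s : ℝ) r)] deriv fun x => -Real.exp (-A x) := by
    filter_upwards [hderiv] with x hx
    rw [hx]
    exact mul_nonneg (extendZero_nonneg g x) (Real.exp_pos _).le
  have hL : ∫⁻ t in Icc s r, (g t : ℝ≥0∞) *
        ENNReal.ofReal (Real.exp (-∫ q in Icc s t, (g q : ℝ) ∂halfLine)) ∂halfLine
      = ENNReal.ofReal (∫ x in Icc (s : ℝ) r, deriv (fun x => -Real.exp (-A x)) x) := by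
    rw [ofReal_integral_eq_lintegral_ofReal hI h0,
      lintegral_congr_ae (hderiv.mono fun x hx => congrArg ENNReal.ofReal hx),
      ← map_val_halfLine_restrict_Icc, measurableEmbedding_val_nnreal.lintegral_map]
    refine setLIntegral_congr_fun measurableSet_Icc fun t ht => ?_
    rw [extendZero_coe, ENNReal.ofReal_mul (NNReal.coe_nonneg _), ENNReal.ofReal_coe_nnreal, hA]
    simp only [intervalIntegral_extendZero g ht.1]
  rw [hL, ← hAr, ← ENNReal.ofReal_add hV.1 (Real.exp_pos _).le, ENNReal.ofReal_le_one]
  have := hV.2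
  simp only [neg_zero, Real.exp_zero] at this
  linarith

namespace KineticModel

variable {d : ℕ} (M : KineticModel d)

/-! ### The absorption factor -/

theorem absorption_self (t : ℝ≥0) (v : M.V) : M.absorption t t v = 1 := by
  simp [absorption, halfLine_singleton]

theorem ae_locallyIntegrable_Sig :
    ∀ᵐ v ∂M.velMeasure, LocallyIntegrable (fun t => (M.Sig t v : ℝ)) halfLine :=
  M.locallyIntegrable_Sig

theorem ae_phaseMeasure_of_ae_velMeasure {P : M.V → Prop} (h : ∀ᵐ v ∂M.velMeasure, P v) :
    ∀ᵐ p ∂M.phaseMeasure, P p.2 :=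
  Measure.quasiMeasurePreserving_snd.ae h

theorem absorption_mul {v : M.V} (hv : LocallyIntegrable (fun t => (M.Sig t v : ℝ)) halfLine)
    {s r t : ℝ≥0} (hsr : s ≤ r) (hrt : r ≤ t) :
    M.absorption t r v * M.absorption r s v = M.absorption t s v := by
  rw [absorption, absorption, absorption, ← Real.exp_add,
    setIntegral_Icc_halfLine_add hv hsr hrt]
  congr 1
  ring

theorem continuousOn_absorption {v : M.V}
    (hv : LocallyIntegrable (fun t => (M.Sig t v : ℝ)) halfLine) :
    ContinuousOn (fun q : ℝ≥0 × ℝ≥0 => M.absorption q.1 q.2 v) {q | q.2 ≤ q.1} :=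
  Real.continuous_exp.comp_continuousOn (continuousOn_setIntegral_Icc_halfLine hv).neg

theorem lintegral_Sig_mul_absorption_add_le_one {v : M.V}
    (hv : LocallyIntegrable (fun t => (M.Sig t v : ℝ)) halfLine) {s r : ℝ≥0} (hsr : s ≤ r) :
    ∫⁻ t in Icc s r, (M.Sig t v : ℝ≥0∞) * ENNReal.ofReal (M.absorption t s v) ∂halfLine
      + ENNReal.ofReal (M.absorption r s v) ≤ 1 :=
  lintegral_mul_exp_add_exp_le_one hv hsr

/-! ### The evolution family and the perturbation -/

theorem coeFn_U (t s : ℝ≥0) (f : M.State) :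
    M.U t s f =ᵐ[M.phaseMeasure] M.transportFun t s f :=
  MemLp.coeFn_toLp (M.memLp_transportFun t s (Lp.memLp f))

theorem transportFun_self (t : ℝ≥0) (f : EuclideanSpace ℝ (Fin d) × M.V → ℝ) :
    M.transportFun t t f =ᵐ[M.phaseMeasure] f := by
  have h : ∀ᵐ p ∂M.phaseMeasure, p.1 ∈ M.Ω := by
    rw [phaseMeasure_eq, ae_restrict_iff' (M.isOpen_Ω.measurableSet.prod MeasurableSet.univ)]
    exact .of_forall fun p hp => hp.1
  filter_upwards [h] with p hp
  have hm : p ∈ M.reach (t - t) := by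
    rw [mem_reach_iff]
    intro r hr
    have : r = 0 := by simpa using hr
    simpa [this] using hp
  rw [transportFun, indicator_of_mem hm, absorption_self]
  simp

/-- The backward segment of length `δ + ε` is cut at time `δ`; this is the semigroup law for the
indicator. -/
theorem mem_reach_add_iff (δ ε : ℝ≥0) (p : EuclideanSpace ℝ (Fin d) × M.V) :
    p ∈ M.reach (δ + ε) ↔ p ∈ M.reach δ ∧
      (p.1 - (δ : ℝ) • (p.2 : EuclideanSpace ℝ (Fin d)), p.2) ∈ M.reach ε := by
  simp only [mem_reach_iff]
  constructor
  · refine fun h => ⟨fun r hr => h r ⟨hr.1, ?_⟩, fun r hr => ?_⟩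
    · push_cast; exact hr.2.trans (le_add_of_nonneg_right ε.2)
    · have h1 := h (δ + r) ⟨add_nonneg δ.2 hr.1, by push_cast; linarith [hr.2]⟩
      rwa [add_smul, ← sub_sub] at h1
  · rintro ⟨h1, h2⟩ r ⟨hr0, hr⟩
    push_cast at hr
    rcases le_total r δ with h | h
    · exact h1 r ⟨hr0, h⟩
    · have h3 := h2 (r - δ) ⟨sub_nonneg.2 h, by linarith⟩
      rwa [sub_sub, ← add_smul, add_sub_cancel] at h3

/-- The identity is stated almost everywhere because the absorption factors are multiplied at
velocities where `Sig` is locally integrable in time. -/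
theorem transportFun_comp {t r s : ℝ≥0} (hsr : s ≤ r) (hrt : r ≤ t)
    (f : EuclideanSpace ℝ (Fin d) × M.V → ℝ) :
    M.transportFun t r (M.transportFun r s f) =ᵐ[M.phaseMeasure] M.transportFun t s f := by
  filter_upwards [M.ae_phaseMeasure_of_ae_velMeasure M.ae_locallyIntegrable_Sig] with p hp
  have hts : t - s = (t - r) + (r - s) := (tsub_add_tsub_cancel hrt hsr).symm
  have hiff := M.mem_reach_add_iff (t - r) (r - s) p
  rw [← hts] at hiff
  simp only [transportFun]
  by_cases h1 : p ∈ M.reach (t - r)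
  · by_cases h2 : (p.1 - ((t - r : ℝ≥0) : ℝ) • (p.2 : EuclideanSpace ℝ (Fin d)), p.2)
        ∈ M.reach (r - s)
    · rw [indicator_of_mem h1, indicator_of_mem h2, indicator_of_mem (hiff.2 ⟨h1, h2⟩),
        ← mul_assoc, M.absorption_mul hp hsr hrt,
        sub_sub, ← add_smul, hts, NNReal.coe_add]
    · rw [indicator_of_mem h1, indicator_of_notMem h2,
        indicator_of_notMem fun h => h2 (hiff.1 h).2, mul_zero]
  · rw [indicator_of_notMem h1, indicator_of_notMem fun h => h1 (hiff.1 h).1]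

theorem U_self (t : ℝ≥0) : M.U t t = ContinuousLinearMap.id ℝ M.State := by
  ext1 f
  exact Lp.ext ((M.coeFn_U t t f).trans (M.transportFun_self t f))

theorem U_comp (t r s : ℝ≥0) (hsr : s ≤ r) (hrt : r ≤ t) :
    M.U t s = (M.U t r).comp (M.U r s) := by
  ext1 f
  refine Lp.ext ?_
  refine (M.coeFn_U t s f).trans (.trans ?_ (M.coeFn_U t r (M.U r s f)).symm)
  exact ((M.transportFun_congr t r (M.coeFn_U r s f)).trans (M.transportFun_comp hsr hrt f)).symm

theorem norm_U_le (t s : ℝ≥0) : ‖M.U t s‖ ≤ 1 :=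
  LinearMap.mkContinuous_norm_le _ zero_le_one _

theorem U_nonneg (t s : ℝ≥0) {f : M.State} (hf : 0 ≤ f) : 0 ≤ M.U t s f := by
  rw [← Lp.coeFn_nonneg] at hf ⊢
  -- Passing to the representative `|f|` makes the sign hold at every point, including the shifted
  -- ones.
  have h0 := M.transportFun_congr t s (φ := fun p => |f p|) (ψ := f) (by
    filter_upwards [hf] with p hp using abs_of_nonneg hp)
  filter_upwards [M.coeFn_U t s f, h0] with p hp h
  rw [hp, ← h]
  exact indicator_nonneg (fun q _ => mul_nonneg (M.absorption_nonneg t s q.2) (abs_nonneg _)) p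

theorem coeFn_B (t : ℝ≥0) (f : (M.B t).domain) :
    M.B t f =ᵐ[M.phaseMeasure] M.collisionFun t (f : M.State) :=
  MemLp.coeFn_toLp (M.memLp_collisionFun t f.2)

theorem B_nonneg (t : ℝ≥0) (f : (M.B t).domain) (hf : 0 ≤ (f : M.State)) : 0 ≤ M.B t f := by
  rw [← Lp.coeFn_nonneg] at hf ⊢
  have h0 := M.collisionFun_congr t (φ := fun p => |(f : M.State) p|) (ψ := (f : M.State)) (by
    filter_upwards [hf] with p hp using abs_of_nonneg hp)
  filter_upwards [M.coeFn_B t f, h0] with p hp h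
  rw [hp, ← h]
  exact integral_nonneg fun v => mul_nonneg (NNReal.coe_nonneg _) (abs_nonneg _)

/-! ### Joint measurability in time and phase space -/

/-- Rescaling the segment to `θ ∈ [0, 1]` makes the compact parameter set independent of the time,
so that the tube lemma gives openness jointly in time and phase space. -/
theorem isOpen_setOf_mem_reach :
    IsOpen {q : ℝ≥0 × (EuclideanSpace ℝ (Fin d) × M.V) | q.2 ∈ M.reach q.1} := by
  have h : {q : ℝ≥0 × (EuclideanSpace ℝ (Fin d) × M.V) | q.2 ∈ M.reach q.1}
      = {q | ∀ θ ∈ Icc (0 : ℝ) 1,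
        q.2.1 - (θ * (q.1 : ℝ)) • (q.2.2 : EuclideanSpace ℝ (Fin d)) ∈ M.Ω} := by
    ext q
    rw [mem_ofPred_eq, mem_reach_iff, mem_ofPred_eq]
    constructor
    · exact fun h θ hθ => h _ ⟨mul_nonneg hθ.1 q.1.2, mul_le_of_le_one_left q.1.2 hθ.2⟩
    · intro h r hr
      rcases eq_or_lt_of_le q.1.2 with h0 | h0
      · have hr0 : r = 0 := le_antisymm (hr.2.trans_eq h0.symm) hr.1
        simpa [hr0] using h 0 ⟨le_rfl, zero_le_one⟩
      · have := h (r / q.1) ⟨div_nonneg hr.1 h0.le, (div_le_one h0).2 hr.2⟩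
        rwa [div_mul_cancel₀ r (show (q.1 : ℝ) ≠ 0 from h0.ne')] at this
  rw [h, isOpen_iff_mem_nhds]
  intro q hq
  refine (isCompact_Icc : IsCompact (Icc (0 : ℝ) 1)).eventually_forall_of_forall_eventually
    (P := fun (q : ℝ≥0 × (EuclideanSpace ℝ (Fin d) × M.V)) (θ : ℝ) =>
      q.2.1 - (θ * (q.1 : ℝ)) • (q.2.2 : EuclideanSpace ℝ (Fin d)) ∈ M.Ω) ?_
  intro θ hθ
  have hc : Continuous fun z : (ℝ≥0 × (EuclideanSpace ℝ (Fin d) × M.V)) × ℝ =>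
      z.1.2.1 - (z.2 * (z.1.1 : ℝ)) • (z.1.2.2 : EuclideanSpace ℝ (Fin d)) := by fun_prop
  exact (M.isOpen_Ω.preimage hc).mem_nhds (hq θ hθ)

/-- The interval of integration moves with the time; written as an indicator on the product, it
leaves a parameter integral over a fixed measure space. -/
theorem measurable_absorption_left (s : ℝ≥0) :
    Measurable fun q : ℝ≥0 × M.V => M.absorption q.1 s q.2 := by
  have hset : MeasurableSet {z : (ℝ≥0 × M.V) × ℝ≥0 | z.2 ∈ Icc s z.1.1} :=
    (measurableSet_le (α := ℝ≥0) measurable_const measurable_snd).inter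
      (measurableSet_le (α := ℝ≥0) measurable_snd (measurable_fst.comp measurable_fst))
  have h : StronglyMeasurable fun z : (ℝ≥0 × M.V) × ℝ≥0 =>
      {z : (ℝ≥0 × M.V) × ℝ≥0 | z.2 ∈ Icc s z.1.1}.indicator
        (fun z => (M.Sig z.2 z.1.2 : ℝ)) z :=
    ((M.measurable_Sig.comp (measurable_snd.prodMk
      (measurable_snd.comp measurable_fst))).coe_nnreal_real.indicator hset).stronglyMeasurable
  convert Real.measurable_exp.comp (h.integral_prod_right' (ν := halfLine)).measurable.neg
    using 2 with q
  rw [absorption, ← integral_indicator measurableSet_Icc]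
  rfl

theorem measurable_transportFun_left (s : ℝ≥0) {f : EuclideanSpace ℝ (Fin d) × M.V → ℝ}
    (hf : Measurable f) :
    Measurable fun q : ℝ≥0 × (EuclideanSpace ℝ (Fin d) × M.V) => M.transportFun q.1 s f q.2 := by
  have hset : MeasurableSet
      {q : ℝ≥0 × (EuclideanSpace ℝ (Fin d) × M.V) | q.2 ∈ M.reach (q.1 - s)} := by
    have hc : Continuous fun q : ℝ≥0 × (EuclideanSpace ℝ (Fin d) × M.V) => (q.1 - s, q.2) := by
      fun_prop
    exact (M.isOpen_setOf_mem_reach.preimage hc).measurableSet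
  have hshift : Measurable fun q : ℝ≥0 × (EuclideanSpace ℝ (Fin d) × M.V) =>
      (q.2.1 - ((q.1 - s : ℝ≥0) : ℝ) • (q.2.2 : EuclideanSpace ℝ (Fin d)), q.2.2) :=
    Continuous.measurable (by fun_prop)
  have habs : Measurable fun q : ℝ≥0 × (EuclideanSpace ℝ (Fin d) × M.V) =>
      M.absorption q.1 s q.2.2 :=
    (M.measurable_absorption_left s).comp
      (measurable_fst.prodMk (measurable_snd.comp measurable_snd))
  exact (habs.mul (hf.comp hshift)).indicator hset

theorem measurable_Sig_phase :
    Measurable fun q : ℝ≥0 × (EuclideanSpace ℝ (Fin d) × M.V) => (M.Sig q.1 q.2.2 : ℝ≥0∞) :=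
  (M.measurable_Sig.comp
    (measurable_fst.prodMk (measurable_snd.comp measurable_snd))).coe_nnreal_ennreal

theorem measurable_sigma_uncurry : Measurable fun q : ℝ≥0 × M.V => M.sigma q.1 q.2 := by
  have h : Measurable fun z : (ℝ≥0 × M.V) × M.V => (M.b z.1.1 z.2 z.1.2 : ℝ≥0∞) :=
    (M.measurable_b.comp ((measurable_fst.comp measurable_fst).prodMk
      (measurable_snd.prodMk (measurable_snd.comp measurable_fst)))).coe_nnreal_ennreal
  exact h.lintegral_prod_right'

theorem measurable_sigma_phase :
    Measurable fun q : ℝ≥0 × (EuclideanSpace ℝ (Fin d) × M.V) => M.sigma q.1 q.2.2 :=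
  M.measurable_sigma_uncurry.comp (measurable_fst.prodMk (measurable_snd.comp measurable_snd))

theorem measurable_Lp (f : M.State) : Measurable f := (Lp.stronglyMeasurable f).measurable

theorem lintegral_weight_mul_U (w : M.V → ℝ≥0∞) (t s : ℝ≥0) (f : M.State) :
    ∫⁻ p, w p.2 * ‖M.U t s f p‖ₑ ∂M.phaseMeasure
      = ∫⁻ p, w p.2 * ‖M.transportFun t s f p‖ₑ ∂M.phaseMeasure := by
  refine lintegral_congr_ae ?_
  filter_upwards [M.coeFn_U t s f] with p hp
  rw [hp]

theorem measurable_lintegral_weight_mul_U {w : ℝ≥0 → M.V → ℝ≥0∞}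
    (hw : Measurable fun q : ℝ≥0 × (EuclideanSpace ℝ (Fin d) × M.V) => w q.1 q.2.2)
    (s : ℝ≥0) (f : M.State) :
    Measurable fun t => ∫⁻ p, w t p.2 * ‖M.U t s f p‖ₑ ∂M.phaseMeasure := by
  simp only [lintegral_weight_mul_U]
  exact (hw.mul (M.measurable_transportFun_left s (M.measurable_Lp f)).enorm).lintegral_prod_right'

theorem measurable_lintegral_Sig_mul_U (s : ℝ≥0) (f : M.State) :
    Measurable fun t => ∫⁻ p, (M.Sig t p.2 : ℝ≥0∞) * ‖M.U t s f p‖ₑ ∂M.phaseMeasure :=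
  M.measurable_lintegral_weight_mul_U (w := fun t v => M.Sig t v) M.measurable_Sig_phase s f

/-! ### The dissipation estimate -/

/-- The weight and the absorption factor depend on `v` alone, so undoing the shift moves only `f`.
The inequality accounts for points whose shift lies in `Ω` although the backward segment leaves it
or starts outside. -/
theorem lintegral_weight_mul_transportFun_le {w : M.V → ℝ≥0∞} (hw : Measurable w) (t s : ℝ≥0)
    {f : EuclideanSpace ℝ (Fin d) × M.V → ℝ} (hf : Measurable f) :
    ∫⁻ p, w p.2 * ‖M.transportFun t s f p‖ₑ ∂M.phaseMeasure
      ≤ ∫⁻ p, w p.2 * ENNReal.ofReal (M.absorption t s p.2) * ‖f p‖ₑ ∂M.phaseMeasure := by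
  have hT := M.measurePreserving_shift_preimage ((t - s : ℝ≥0) : ℝ)
  have hm : Measurable fun p : EuclideanSpace ℝ (Fin d) × M.V =>
      w p.2 * ENNReal.ofReal (M.absorption t s p.2) * ‖f p‖ₑ :=
    ((hw.comp measurable_snd).mul
      ((M.measurable_absorption t s).comp measurable_snd).ennreal_ofReal).mul hf.enorm
  rw [← hT.lintegral_comp hm]
  calc ∫⁻ p, w p.2 * ‖M.transportFun t s f p‖ₑ ∂M.phaseMeasure
      = ∫⁻ p, (M.reach (t - s)).indicator (fun p => w p.2 *
          ENNReal.ofReal (M.absorption t s p.2) *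
          ‖f (p.1 - ((t - s : ℝ≥0) : ℝ) • (p.2 : EuclideanSpace ℝ (Fin d)), p.2)‖ₑ) p
          ∂M.phaseMeasure := by
        refine lintegral_congr fun p => ?_
        by_cases hp : p ∈ M.reach (t - s)
        · rw [transportFun, indicator_of_mem hp, indicator_of_mem hp, enorm_mul,
            Real.enorm_of_nonneg (M.absorption_nonneg t s p.2), mul_assoc]
        · rw [transportFun, indicator_of_notMem hp, indicator_of_notMem hp, enorm_zero, mul_zero]
    _ ≤ _ := by
        rw [lintegral_indicator (M.isOpen_reach (t - s)).measurableSet]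
        exact lintegral_mono' (M.restrict_reach_le (t - s)) le_rfl

theorem enorm_State (f : M.State) : ‖f‖ₑ = ∫⁻ p, ‖f p‖ₑ ∂M.phaseMeasure := by
  rw [Lp.enorm_def, eLpNorm_one_eq_lintegral_enorm]

/-- After the shift is undone and time is integrated first, each `|f(x, v)|` carries the factor
absorbed plus surviving, which is at most one. Working in `[0, ∞]` needs no prior knowledge of
domains. -/
theorem lintegral_Sig_mul_U_add_le {s r : ℝ≥0} (hsr : s ≤ r) (f : M.State) :
    ∫⁻ t in Icc s r, ∫⁻ p, (M.Sig t p.2 : ℝ≥0∞) * ‖M.U t s f p‖ₑ ∂M.phaseMeasure ∂halfLine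
      + ‖M.U r s f‖ₑ ≤ ‖f‖ₑ := by
  have hf := M.measurable_Lp f
  have h1 : ‖M.U r s f‖ₑ
      ≤ ∫⁻ p, ENNReal.ofReal (M.absorption r s p.2) * ‖f p‖ₑ ∂M.phaseMeasure := by
    have h2 := M.lintegral_weight_mul_transportFun_le (w := fun _ => 1) measurable_const r s hf
    rw [← M.lintegral_weight_mul_U fun _ => 1] at h2
    simpa only [one_mul, ← enorm_State] using h2
  have hm : Measurable fun q : ℝ≥0 × (EuclideanSpace ℝ (Fin d) × M.V) =>
      (M.Sig q.1 q.2.2 : ℝ≥0∞) * ENNReal.ofReal (M.absorption q.1 s q.2.2) * ‖f q.2‖ₑ :=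
    (M.measurable_Sig_phase.mul ((M.measurable_absorption_left s).comp
      (measurable_fst.prodMk (measurable_snd.comp measurable_snd))).ennreal_ofReal).mul
      (hf.comp measurable_snd).enorm
  calc _ ≤ ∫⁻ t in Icc s r, ∫⁻ p, (M.Sig t p.2 : ℝ≥0∞) *
          ENNReal.ofReal (M.absorption t s p.2) * ‖f p‖ₑ ∂M.phaseMeasure ∂halfLine
        + ∫⁻ p, ENNReal.ofReal (M.absorption r s p.2) * ‖f p‖ₑ ∂M.phaseMeasure := by
        refine add_le_add (lintegral_mono fun t => ?_) h1
        rw [lintegral_weight_mul_U M (fun v => (M.Sig t v : ℝ≥0∞))]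
        exact M.lintegral_weight_mul_transportFun_le
          (M.measurable_Sig_right t).coe_nnreal_ennreal t s hf
    _ = ∫⁻ p, (∫⁻ t in Icc s r, (M.Sig t p.2 : ℝ≥0∞) *
          ENNReal.ofReal (M.absorption t s p.2) ∂halfLine
          + ENNReal.ofReal (M.absorption r s p.2)) * ‖f p‖ₑ ∂M.phaseMeasure := by
        rw [lintegral_lintegral_swap hm.aemeasurable, ← lintegral_add_right]
        · refine lintegral_congr fun p => ?_
          rw [lintegral_mul_const' _ _ enorm_ne_top, add_mul]
        · exact ((M.measurable_absorption r s).comp measurable_snd).ennreal_ofReal.mul hf.enorm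
    _ ≤ ∫⁻ p, ‖f p‖ₑ ∂M.phaseMeasure := by
        refine lintegral_mono_ae ?_
        filter_upwards [M.ae_phaseMeasure_of_ae_velMeasure M.ae_locallyIntegrable_Sig] with p hp
        exact mul_le_of_le_one_left' (M.lintegral_Sig_mul_absorption_add_le_one hp hsr)
    _ = ‖f‖ₑ := (M.enorm_State f).symm

/-! ### Domains and norms -/

theorem mem_SigOp_domain_iff (t : ℝ≥0) (f : M.State) : f ∈ (M.SigOp t).domain ↔
    ∫⁻ p, (M.Sig t p.2 : ℝ≥0∞) * ‖f p‖ₑ ∂M.phaseMeasure < ∞ := Iff.rfl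

/-- The exceptional set of times is chosen before `f`, which the inclusion of the domains requires.
-/
theorem ae_sigma_le :
    ∀ᵐ t ∂halfLine, ∀ f : M.State, ∫⁻ p, M.sigma t p.2 * ‖f p‖ₑ ∂M.phaseMeasure
      ≤ ∫⁻ p, (M.Sig t p.2 : ℝ≥0∞) * ‖f p‖ₑ ∂M.phaseMeasure := by
  have h : ∀ᵐ q ∂halfLine.prod M.velMeasure, M.sigma q.1 q.2 ≤ (M.Sig q.1 q.2 : ℝ≥0∞) :=
    M.subcritical
  filter_upwards [Measure.ae_ae_of_ae_prod h] with t ht f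
  refine lintegral_mono_ae ?_
  filter_upwards [M.ae_phaseMeasure_of_ae_velMeasure ht] with p hp
  exact mul_le_mul_left hp _

theorem ae_SigOp_domain_le : ∀ᵐ t ∂halfLine, (M.SigOp t).domain ≤ (M.B t).domain := by
  filter_upwards [M.ae_sigma_le] with t ht f hf
  exact (ht f).trans_lt hf

theorem ae_U_mem_SigOp_domain (s : ℝ≥0) (f : M.State) :
    ∀ᵐ t ∂halfLine, s ≤ t → M.U t s f ∈ (M.SigOp t).domain := by
  -- On each bounded interval the time integral is at most `‖f‖ₑ`, hence its integrand is finite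
  -- a.e.; countably many intervals exhaust `[s, ∞)`.
  have h : ∀ n : ℕ, ∀ᵐ t ∂halfLine, t ∈ Icc s (s + n) → M.U t s f ∈ (M.SigOp t).domain := by
    intro n
    rw [← ae_restrict_iff' measurableSet_Icc]
    refine ae_lt_top (M.measurable_lintegral_Sig_mul_U s f) ?_
    exact ((le_self_add.trans (M.lintegral_Sig_mul_U_add_le
      (le_add_of_nonneg_right n.cast_nonneg) f)).trans_lt enorm_lt_top).ne
  filter_upwards [ae_all_iff.2 h] with t ht hst
  obtain ⟨n, hn⟩ := exists_nat_ge t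
  exact ht n ⟨hst, hn.trans (le_add_of_nonneg_left s.2)⟩

theorem ae_U_mem_B_domain (s : ℝ≥0) (f : M.State) :
    ∀ᵐ t ∂halfLine, s ≤ t → M.U t s f ∈ (M.B t).domain := by
  filter_upwards [M.ae_SigOp_domain_le, M.ae_U_mem_SigOp_domain s f] with t h1 h2 hst
  exact h1 (h2 hst)

/-- No membership is assumed: outside the domain the two conventions, value `0` and `∞.toReal = 0`,
agree. -/
theorem norm_SigOp_applyOrZero (t : ℝ≥0) (f : M.State) :
    ‖(M.SigOp t).applyOrZero f‖
      = (∫⁻ p, (M.Sig t p.2 : ℝ≥0∞) * ‖f p‖ₑ ∂M.phaseMeasure).toReal := by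
  by_cases h : f ∈ (M.SigOp t).domain
  · rw [LinearPMap.applyOrZero, dif_pos h, ← toReal_enorm, enorm_State]
    congr 1
    refine lintegral_congr_ae ?_
    have h1 : M.SigOp t ⟨f, h⟩ =ᵐ[M.phaseMeasure] fun p => (M.Sig t p.2 : ℝ) * f p :=
      MemLp.coeFn_toLp (M.memLp_sig_mul t h)
    filter_upwards [h1] with p hp
    rw [hp, enorm_mul]
    congr 1
    exact NNReal.enorm_eq _
  · rw [LinearPMap.applyOrZero, dif_neg h, norm_zero]
    rw [mem_SigOp_domain_iff, not_lt, top_le_iff] at h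
    rw [h, ENNReal.toReal_top]

theorem enorm_B_applyOrZero_le (t : ℝ≥0) (f : M.State) :
    ‖(M.B t).applyOrZero f‖ₑ ≤ ∫⁻ p, M.sigma t p.2 * ‖f p‖ₑ ∂M.phaseMeasure := by
  by_cases h : f ∈ (M.B t).domain
  · rw [LinearPMap.applyOrZero, dif_pos h, enorm_State,
      ← M.lintegral_collision t (Lp.aestronglyMeasurable f)]
    refine lintegral_mono_ae ?_
    filter_upwards [M.coeFn_B t ⟨f, h⟩] with p hp
    rw [hp]
    exact enorm_integral_le_lintegral_enorm _
  · rw [LinearPMap.applyOrZero, dif_neg h, enorm_zero]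
    exact zero_le

end KineticModel

/-! ### Measurability of functions with values in `L¹` -/

/-- Balls form a basis of the topology, and by second countability they generate the Borel sets; the
preimage of a ball is a sublevel set of a distance function. -/
theorem measurable_of_measurable_edist {α X : Type*} [MeasurableSpace α] [PseudoEMetricSpace X]
    [SecondCountableTopology X] [MeasurableSpace X] [BorelSpace X] {F : α → X}
    (hF : ∀ c, Measurable fun a => edist (F a) c) : Measurable F := by
  have hb : TopologicalSpace.IsTopologicalBasis
      {U : Set X | ∃ c ε, U = Metric.eball c ε} := by
    refine TopologicalSpace.isTopologicalBasis_of_isOpen_of_nhds ?_ fun x u hx hu => ?_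
    · rintro _ ⟨c, ε, rfl⟩
      exact Metric.isOpen_eball
    · obtain ⟨ε, hε, h⟩ := Metric.nhds_basis_eball.mem_iff.1 (hu.mem_nhds hx)
      exact ⟨_, ⟨x, ε, rfl⟩, Metric.mem_eball_self hε, h⟩
  rw [BorelSpace.measurable_eq (α := X), borel_eq_generateFrom_of_subbasis hb.eq_generateFrom]
  refine measurable_generateFrom ?_
  rintro _ ⟨c, ε, rfl⟩
  exact measurableSet_lt (hF c) measurable_const

/-- The distance of `F a` to a fixed `c` is an integral of a jointly measurable function of `(a,
x)`, hence measurable in `a` by Tonelli. Separability of `L¹`, from the countably generated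
σ-algebra, does the rest. -/
theorem stronglyMeasurable_Lp_one_of_uncurry {α X : Type*} [MeasurableSpace α] [MeasurableSpace X]
    {μ : Measure X} [SFinite μ] [MeasurableSpace.CountablyGenerated X]
    {G : α → X → ℝ} (hG : Measurable (Function.uncurry G)) {F : α → Lp ℝ 1 μ}
    (hF : ∀ a, F a =ᵐ[μ] G a) : StronglyMeasurable F := by
  borelize ↥(Lp ℝ 1 μ)
  have : Fact ((1 : ℝ≥0∞) ≠ ∞) := ⟨ENNReal.one_ne_top⟩
  refine (measurable_of_measurable_edist fun c => ?_).stronglyMeasurable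
  have h : ∀ a, edist (F a) c = ∫⁻ x, ‖G a x - c x‖ₑ ∂μ := by
    intro a
    rw [Lp.edist_def, eLpNorm_one_eq_lintegral_enorm]
    refine lintegral_congr_ae ?_
    filter_upwards [hF a] with x hx
    rw [Pi.sub_apply, hx]
  simp only [h]
  exact (hG.sub ((Lp.stronglyMeasurable c).measurable.comp
    measurable_snd)).enorm.lintegral_prod_right'

/-! ### Measurability of `B(t)U(t,s)f` and the integrated estimates -/

namespace KineticModel

variable {d : ℕ} (M : KineticModel d)

theorem measurable_collisionFun_transportFun (s : ℝ≥0) (f : M.State) :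
    Measurable fun q : ℝ≥0 × (EuclideanSpace ℝ (Fin d) × M.V) =>
      M.collisionFun q.1 (M.transportFun q.1 s f) q.2 := by
  have hb : Measurable fun z : (ℝ≥0 × (EuclideanSpace ℝ (Fin d) × M.V)) × M.V =>
      (M.b z.1.1 z.1.2.2 z.2 : ℝ) :=
    (M.measurable_b.comp ((measurable_fst.comp measurable_fst).prodMk
      ((measurable_snd.comp (measurable_snd.comp measurable_fst)).prodMk
        measurable_snd))).coe_nnreal_real
  have ht : Measurable fun z : (ℝ≥0 × (EuclideanSpace ℝ (Fin d) × M.V)) × M.V =>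
      M.transportFun z.1.1 s f (z.1.2.1, z.2) :=
    (M.measurable_transportFun_left s (M.measurable_Lp f)).comp
      ((measurable_fst.comp measurable_fst).prodMk
        ((measurable_fst.comp (measurable_snd.comp measurable_fst)).prodMk measurable_snd))
  exact (hb.mul ht).stronglyMeasurable.integral_prod_right'.measurable

/-- The times at which `U(t,s)f` lies in the domain form a measurable set, being those where a
measurable weighted integral is finite. Cutting the explicit representative off to this set matches
`applyOrZero` at every `t`. -/
theorem stronglyMeasurable_B_U (s : ℝ≥0) (f : M.State) :
    StronglyMeasurable fun t => (M.B t).applyOrZero (M.U t s f) := by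
  have hD : MeasurableSet {t | M.U t s f ∈ (M.B t).domain} :=
    measurableSet_lt (M.measurable_lintegral_weight_mul_U M.measurable_sigma_phase s f)
      measurable_const
  have hD2 : MeasurableSet {q : ℝ≥0 × (EuclideanSpace ℝ (Fin d) × M.V) |
      M.U q.1 s f ∈ (M.B q.1).domain} := measurable_fst hD
  refine stronglyMeasurable_Lp_one_of_uncurry
    (G := fun t p => {q : ℝ≥0 × (EuclideanSpace ℝ (Fin d) × M.V) |
      M.U q.1 s f ∈ (M.B q.1).domain}.indicator
        (fun q => M.collisionFun q.1 (M.transportFun q.1 s f) q.2) (t, p))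
    ((M.measurable_collisionFun_transportFun s f).indicator hD2) fun t => ?_
  by_cases h : M.U t s f ∈ (M.B t).domain
  · rw [LinearPMap.applyOrZero, dif_pos h]
    filter_upwards [M.coeFn_B t ⟨_, h⟩, M.collisionFun_congr t (M.coeFn_U t s f)] with p h1 h2
    rw [indicator_of_mem (by exact h), h1, h2]
  · rw [LinearPMap.applyOrZero, dif_neg h]
    filter_upwards [Lp.coeFn_zero ℝ 1 M.phaseMeasure] with p hp
    rw [indicator_of_notMem (by exact h), hp, Pi.zero_apply]

theorem ae_norm_B_U_le (s : ℝ≥0) (f : M.State) : ∀ᵐ t ∂halfLine, s ≤ t →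
    ‖(M.B t).applyOrZero (M.U t s f)‖ ≤ ‖(M.SigOp t).applyOrZero (M.U t s f)‖ := by
  filter_upwards [M.ae_sigma_le, M.ae_U_mem_SigOp_domain s f] with t h1 h2 hst
  rw [norm_SigOp_applyOrZero, ← toReal_enorm]
  exact ENNReal.toReal_mono (h2 hst).ne ((M.enorm_B_applyOrZero_le t _).trans (h1 _))

theorem integrableOn_norm_SigOp_U {s r : ℝ≥0} (hsr : s ≤ r) (f : M.State) :
    IntegrableOn (fun t => ‖(M.SigOp t).applyOrZero (M.U t s f)‖) (Icc s r) halfLine := by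
  simp only [norm_SigOp_applyOrZero]
  refine integrable_toReal_of_lintegral_ne_top
    (M.measurable_lintegral_Sig_mul_U s f).aemeasurable ?_
  exact ((le_self_add.trans (M.lintegral_Sig_mul_U_add_le hsr f)).trans_lt enorm_lt_top).ne

theorem integrableOn_B_U {s r : ℝ≥0} (hsr : s ≤ r) (f : M.State) :
    IntegrableOn (fun t => (M.B t).applyOrZero (M.U t s f)) (Icc s r) halfLine := by
  refine (M.integrableOn_norm_SigOp_U hsr f).mono'
    (M.stronglyMeasurable_B_U s f).aestronglyMeasurable ?_
  rw [ae_restrict_iff' measurableSet_Icc]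
  filter_upwards [M.ae_norm_B_U_le s f] with t ht hm
  exact ht hm.1

theorem integral_norm_B_U_le {s r : ℝ≥0} (hsr : s ≤ r) (f : M.State) :
    ∫ t in Icc s r, ‖(M.B t).applyOrZero (M.U t s f)‖ ∂halfLine
      ≤ ∫ t in Icc s r, ‖(M.SigOp t).applyOrZero (M.U t s f)‖ ∂halfLine := by
  refine integral_mono_ae (M.integrableOn_B_U hsr f).norm (M.integrableOn_norm_SigOp_U hsr f) ?_
  rw [Filter.EventuallyLE, ae_restrict_iff' measurableSet_Icc]
  filter_upwards [M.ae_norm_B_U_le s f] with t ht hm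
  exact ht hm.1

theorem integral_norm_SigOp_U_le {s r : ℝ≥0} (hsr : s ≤ r) (f : M.State) :
    ∫ t in Icc s r, ‖(M.SigOp t).applyOrZero (M.U t s f)‖ ∂halfLine ≤ ‖f‖ - ‖M.U r s f‖ := by
  have h := M.lintegral_Sig_mul_U_add_le hsr f
  have hfin := ((le_self_add.trans h).trans_lt enorm_lt_top).ne
  have hm := M.measurable_lintegral_Sig_mul_U s f
  simp only [norm_SigOp_applyOrZero]
  rw [integral_toReal hm.aemeasurable (ae_lt_top hm hfin), le_sub_iff_add_le, ← toReal_enorm,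
    ← toReal_enorm f, ← ENNReal.toReal_add hfin enorm_ne_top]
  exact ENNReal.toReal_mono enorm_ne_top h

end KineticModel

/-! ### Approximation in `L¹` of an open set -/

/-- Integrable functions on an open set are approximated by continuous functions with compact
support which vanish outside of the open set. -/
theorem MeasureTheory.IntegrableOn.exists_continuous_lintegral_sub_le {d : ℕ}
    {s : Set (EuclideanSpace ℝ (Fin d))} (hs : IsOpen s) {φ : EuclideanSpace ℝ (Fin d) → ℝ}
    (hφ : IntegrableOn φ s) {ε : ℝ≥0∞} (hε : ε ≠ 0) :
    ∃ g : EuclideanSpace ℝ (Fin d) → ℝ, Continuous g ∧ HasCompactSupport g ∧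
      (∀ x ∉ s, g x = 0) ∧ ∫⁻ x in s, ‖φ x - g x‖ₑ ≤ ε := by
  obtain ⟨g, hgs, hg, hgc, hgi⟩ :=
    ((integrable_indicator_iff hs.measurableSet).2 hφ).exists_hasCompactSupport_lintegral_sub_le
      (ENNReal.half_pos hε).ne'
  have hg' : ∫⁻ x in s, ‖φ x - g x‖ₑ ≤ ε / 2 := by
    refine le_trans ?_ ((setLIntegral_le_lintegral s _).trans hg)
    refine (setLIntegral_congr_fun hs.measurableSet fun x hx => ?_).le
    simp only [indicator_of_mem hx]
  have hpos : ∀ n : ℕ, (0 : ℝ) < 1 / ((n : ℝ) + 1) := fun n => Nat.one_div_pos_of_nat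
  -- Continuous cutoffs vanishing off `s`. As `sᶜ` is closed, they tend to `1` at each point of `s`,
  -- so `χ n * g → g` in `L¹(s)` by domination.
  let χ : ℕ → EuclideanSpace ℝ (Fin d) → ℝ := fun n x => 1 - (thickenedIndicator (hpos n) sᶜ x : ℝ)
  have hχc : ∀ n, Continuous (χ n) := fun n =>
    continuous_const.sub (NNReal.continuous_coe.comp (thickenedIndicator (hpos n) sᶜ).continuous)
  have hχ1 : ∀ n x, ‖g x - χ n x * g x‖ₑ ≤ ‖g x‖ₑ := by
    intro n x
    have h : g x - χ n x * g x = (thickenedIndicator (hpos n) sᶜ x : ℝ) * g x := by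
      simp only [χ]; ring
    rw [h, enorm_mul, NNReal.enorm_eq]
    exact mul_le_of_le_one_left' (by exact_mod_cast thickenedIndicator_le_one _ _ _)
  have hχs : ∀ n, ∀ x ∉ s, χ n x = 0 := by
    intro n x hx
    simp only [χ, thickenedIndicator_one (hpos n) sᶜ (mem_compl hx), NNReal.coe_one, sub_self]
  have hχt : ∀ x ∈ s, Filter.Tendsto (fun n => χ n x) Filter.atTop (𝓝 1) := by
    intro x hx
    have h := tendsto_pi_nhds.1 (thickenedIndicator_tendsto_indicator_closure hpos
      tendsto_one_div_add_atTop_nhds_zero_nat sᶜ) x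
    rw [hs.isClosed_compl.closure_eq, indicator_of_notMem (by simpa using hx)] at h
    simpa [χ] using ((NNReal.tendsto_coe.2 h).const_sub 1)
  have hlim : Filter.Tendsto (fun n => ∫⁻ x in s, ‖g x - χ n x * g x‖ₑ) Filter.atTop (𝓝 0) := by
    rw [← lintegral_zero (μ := volume.restrict s)]
    refine tendsto_lintegral_of_dominated_convergence (fun x => ‖g x‖ₑ)
      (fun n => ?_) (fun n => .of_forall (hχ1 n)) hgi.integrableOn.2.ne ?_
    · exact (hgc.sub ((hχc n).mul hgc)).measurable.enorm
    · rw [ae_restrict_iff' hs.measurableSet]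
      refine .of_forall fun x hx => ?_
      have h := (((hχt x hx).mul_const (g x)).const_sub (g x)).enorm
      simpa using h
  obtain ⟨n, hn⟩ := (hlim.eventually_le_const (ENNReal.half_pos hε)).exists
  refine ⟨fun x => χ n x * g x, (hχc n).mul hgc, hgs.mul_left, fun x hx => ?_, ?_⟩
  · simp only [hχs n x hx, zero_mul]
  · calc ∫⁻ x in s, ‖φ x - χ n x * g x‖ₑ
        ≤ ∫⁻ x in s, (‖φ x - g x‖ₑ + ‖g x - χ n x * g x‖ₑ) := by
          refine lintegral_mono fun x => ?_
          rw [← sub_add_sub_cancel (φ x) (g x)]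
          exact enorm_add_le _ _
      _ = (∫⁻ x in s, ‖φ x - g x‖ₑ) + ∫⁻ x in s, ‖g x - χ n x * g x‖ₑ :=
          lintegral_add_right _ (hgc.sub ((hχc n).mul hgc)).measurable.enorm
      _ ≤ ε := (add_le_add hg' hn).trans_eq (ENNReal.add_halves ε)

namespace KineticModel

variable {d : ℕ} (M : KineticModel d)

/-! ### Free transport of functions of the position at a fixed velocity -/

/-- The free transport with absorbing boundary, during the time `δ` and with velocity `v`. -/
noncomputable def stream (v : M.V) (δ : ℝ≥0) (g : EuclideanSpace ℝ (Fin d) → ℝ) :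
    EuclideanSpace ℝ (Fin d) → ℝ :=
  {x | (x, v) ∈ M.reach δ}.indicator fun x =>
    g (x - (δ : ℝ) • (v : EuclideanSpace ℝ (Fin d)))

theorem stream_sub (v : M.V) (δ : ℝ≥0) (g h : EuclideanSpace ℝ (Fin d) → ℝ) :
    M.stream v δ (fun x => g x - h x) = fun x => M.stream v δ g x - M.stream v δ h x := by
  ext x
  by_cases hx : x ∈ {x | (x, v) ∈ M.reach δ}
  · simp only [stream, indicator_of_mem hx]
  · simp only [stream, indicator_of_notMem hx, sub_zero]

theorem measurable_stream (v : M.V) (δ : ℝ≥0) {g : EuclideanSpace ℝ (Fin d) → ℝ}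
    (hg : Measurable g) : Measurable (M.stream v δ g) := by
  have hc : Continuous fun x : EuclideanSpace ℝ (Fin d) => (x, v) := by fun_prop
  exact (hg.comp (measurable_id.sub_const _)).indicator
    ((M.isOpen_reach δ).preimage hc).measurableSet

theorem enorm_stream_le (v : M.V) (δ : ℝ≥0) (g : EuclideanSpace ℝ (Fin d) → ℝ)
    (x : EuclideanSpace ℝ (Fin d)) :
    ‖M.stream v δ g x‖ₑ ≤ ‖g (x - (δ : ℝ) • (v : EuclideanSpace ℝ (Fin d)))‖ₑ :=
  enorm_indicator_le_enorm_self _ _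

/-- Where the transported function is nonzero, the shifted point is still in `Ω`; translation
invariance gives the contraction. -/
theorem lintegral_stream_le (v : M.V) (δ : ℝ≥0) (g : EuclideanSpace ℝ (Fin d) → ℝ) :
    ∫⁻ x in M.Ω, ‖M.stream v δ g x‖ₑ ≤ ∫⁻ x in M.Ω, ‖g x‖ₑ := by
  rw [← lintegral_indicator M.isOpen_Ω.measurableSet fun x => ‖g x‖ₑ,
    ← lintegral_sub_right_eq_self (μ := volume) (M.Ω.indicator fun x => ‖g x‖ₑ)
      ((δ : ℝ) • (v : EuclideanSpace ℝ (Fin d)))]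
  refine (setLIntegral_le_lintegral _ _).trans (lintegral_mono fun x => ?_)
  by_cases hx : x ∈ {x | (x, v) ∈ M.reach δ}
  · have h := (M.mem_reach_iff δ (x, v)).1 hx δ ⟨δ.2, le_rfl⟩
    rw [indicator_of_mem (by exact h)]
    exact M.enorm_stream_le v δ g x
  · rw [stream, indicator_of_notMem hx, enorm_zero]
    exact zero_le

/-- If the segment stays in `Ω`, it does so for nearby times and the indicator is locally constant.
If it leaves `Ω` but its endpoint is inside, it left strictly earlier and the value is `0` nearby.
If the endpoint is outside, `g` vanishes there and continuity of `g` squeezes the value to `0`. -/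
theorem continuous_stream_left (v : M.V) {g : EuclideanSpace ℝ (Fin d) → ℝ} (hg : Continuous g)
    (h0 : ∀ x ∉ M.Ω, g x = 0) (x : EuclideanSpace ℝ (Fin d)) :
    Continuous fun δ => M.stream v δ g x := by
  have hc : Continuous fun δ : ℝ≥0 => g (x - (δ : ℝ) • (v : EuclideanSpace ℝ (Fin d))) := by
    fun_prop
  rw [continuous_iff_continuousAt]
  intro δ
  by_cases hx : (x, v) ∈ M.reach δ
  · have hc2 : Continuous fun ε : ℝ≥0 => (ε, (x, v)) := by fun_prop
    have hev : ∀ᶠ ε in 𝓝 δ, (x, v) ∈ M.reach ε :=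
      (M.isOpen_setOf_mem_reach.preimage hc2).mem_nhds hx
    refine hc.continuousAt.congr (hev.mono fun ε hε => ?_)
    exact (indicator_of_mem (s := {x | (x, v) ∈ M.reach ε}) hε fun x =>
      g (x - (ε : ℝ) • (v : EuclideanSpace ℝ (Fin d)))).symm
  · have hδ : M.stream v δ g x = 0 := indicator_of_notMem (s := {x | (x, v) ∈ M.reach δ}) hx _
    rw [ContinuousAt, hδ]
    by_cases hm : x - (δ : ℝ) • (v : EuclideanSpace ℝ (Fin d)) ∈ M.Ω
    · rw [mem_reach_iff] at hx
      push Not at hx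
      obtain ⟨r, hr, hrm⟩ := hx
      have hlt : r < δ := lt_of_le_of_ne hr.2 fun h => hrm (by rw [h]; exact hm)
      have hev : ∀ᶠ ε : ℝ≥0 in 𝓝 δ, r < ε := 
        (NNReal.continuous_coe.tendsto δ).eventually_const_lt hlt
      refine tendsto_const_nhds.congr' (hev.mono fun ε hε => ?_)
      refine (indicator_of_notMem (s := {x | (x, v) ∈ M.reach ε}) (fun h => hrm ?_) _).symm
      exact (M.mem_reach_iff ε (x, v)).1 h r ⟨hr.1, hε.le⟩
    · have hlim := hc.tendsto δ
      rw [h0 _ hm] at hlim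
      refine squeeze_zero_norm (fun ε => ?_) (tendsto_norm_zero.comp hlim)
      exact norm_indicator_le_norm_self _ _

theorem tendsto_lintegral_stream_of_continuous (v : M.V) {g : EuclideanSpace ℝ (Fin d) → ℝ}
    (hg : Continuous g) (hgs : HasCompactSupport g) (h0 : ∀ x ∉ M.Ω, g x = 0) (δ : ℝ≥0) :
    Filter.Tendsto (fun ε => ∫⁻ x in M.Ω, ‖M.stream v ε g x - M.stream v δ g x‖ₑ) (𝓝 δ)
      (𝓝 0) := by
  obtain ⟨C, hC⟩ := hg.bounded_above_of_compact_support hgs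
  obtain ⟨R, hR⟩ := hgs.isCompact.isBounded.subset_closedBall 0
  -- For times below `δ + 1` a support contained in the ball of radius `R` moves by at most `(δ +
  -- 1)‖v‖`, so one ball serves for the domination.
  set ρ : ℝ := R + ((δ : ℝ) + 1) * ‖(v : EuclideanSpace ℝ (Fin d))‖ with hρ
  have hbound : ∀ ε : ℝ≥0, ε < δ + 1 → ∀ x, ‖M.stream v ε g x‖ₑ
      ≤ (Metric.closedBall (0 : EuclideanSpace ℝ (Fin d)) ρ).indicator
        (fun _ => ENNReal.ofReal C) x := by
    intro ε hε x
    refine (M.enorm_stream_le v ε g x).trans ?_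
    by_cases hx : x ∈ Metric.closedBall (0 : EuclideanSpace ℝ (Fin d)) ρ
    · rw [indicator_of_mem hx, ← ofReal_norm]
      exact ENNReal.ofReal_le_ofReal (hC _)
    · have hz : g (x - (ε : ℝ) • (v : EuclideanSpace ℝ (Fin d))) = 0 := by
        by_contra hne
        have h1 := hR (subset_tsupport g hne)
        rw [mem_closedBall_zero_iff] at h1 hx
        refine hx ?_
        have h2 : ‖x‖ ≤ ‖x - (ε : ℝ) • (v : EuclideanSpace ℝ (Fin d))‖
            + ‖(ε : ℝ) • (v : EuclideanSpace ℝ (Fin d))‖ := by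
          simpa using norm_add_le (x - (ε : ℝ) • (v : EuclideanSpace ℝ (Fin d)))
            ((ε : ℝ) • (v : EuclideanSpace ℝ (Fin d)))
        have h3 : (ε : ℝ) ≤ δ + 1 := by exact_mod_cast hε.le
        rw [norm_smul, Real.norm_of_nonneg ε.coe_nonneg] at h2
        have h4 := mul_le_mul_of_nonneg_right h3 (norm_nonneg (v : EuclideanSpace ℝ (Fin d)))
        exact h2.trans (add_le_add h1 h4)
      rw [hz, enorm_zero]
      exact zero_le
  rw [← lintegral_zero (μ := volume.restrict M.Ω)]
  refine tendsto_lintegral_filter_of_dominated_convergence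
    (fun x => (Metric.closedBall (0 : EuclideanSpace ℝ (Fin d)) ρ).indicator
        (fun _ => ENNReal.ofReal C) x
      + (Metric.closedBall (0 : EuclideanSpace ℝ (Fin d)) ρ).indicator
        (fun _ => ENNReal.ofReal C) x) (.of_forall fun ε => ?_) ?_ ?_ (.of_forall fun x => ?_)
  · exact ((M.measurable_stream v ε hg.measurable).sub
      (M.measurable_stream v δ hg.measurable)).enorm
  · filter_upwards [eventually_lt_nhds (lt_add_one δ)] with ε hε
    exact .of_forall fun x => enorm_sub_le.trans
      (add_le_add (hbound ε hε x) (hbound δ (lt_add_one δ) x))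
  · have hfin : ∫⁻ x in M.Ω, (Metric.closedBall (0 : EuclideanSpace ℝ (Fin d)) ρ).indicator
        (fun _ => ENNReal.ofReal C) x < ∞ := by
      refine (setLIntegral_le_lintegral _ _).trans_lt ?_
      rw [lintegral_indicator_const Metric.isClosed_closedBall.measurableSet]
      exact ENNReal.mul_lt_top ENNReal.ofReal_lt_top measure_closedBall_lt_top
    rw [lintegral_add_left (measurable_const.indicator Metric.isClosed_closedBall.measurableSet)]
    exact (ENNReal.add_lt_top.2 ⟨hfin, hfin⟩).ne
  · have h := (((M.continuous_stream_left v hg h0 x).tendsto δ).sub_const (M.stream v δ g x)).enorm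
    simpa using h

/-- Density and contractivity: `φ` is replaced by a continuous `g` at a cost of `η / 3` at each of
the two times, uniformly in time. -/
theorem tendsto_lintegral_stream (v : M.V) {φ : EuclideanSpace ℝ (Fin d) → ℝ}
    (hm : Measurable φ) (hφ : IntegrableOn φ M.Ω) (δ : ℝ≥0) :
    Filter.Tendsto (fun ε => ∫⁻ x in M.Ω, ‖M.stream v ε φ x - M.stream v δ φ x‖ₑ) (𝓝 δ)
      (𝓝 0) := by
  rw [ENNReal.tendsto_nhds_zero]
  intro η hη
  have h3 : η / 3 ≠ 0 := (ENNReal.div_pos hη.ne' (by simp)).ne'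
  obtain ⟨g, hg, hgs, h0, hφg⟩ := hφ.exists_continuous_lintegral_sub_le M.isOpen_Ω h3
  have hmid := M.tendsto_lintegral_stream_of_continuous v hg hgs h0 δ
  filter_upwards [hmid.eventually_le_const (pos_iff_ne_zero.2 h3)] with ε hε
  have hd : ∀ ε', ∫⁻ x in M.Ω, ‖M.stream v ε' φ x - M.stream v ε' g x‖ₑ ≤ η / 3 := fun ε' =>
    (by simpa only [stream_sub] using M.lintegral_stream_le v ε' fun x => φ x - g x :
      _ ≤ ∫⁻ x in M.Ω, ‖φ x - g x‖ₑ).trans hφg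
  have hmeas : ∀ ε', Measurable fun x => ‖M.stream v ε' φ x - M.stream v ε' g x‖ₑ := fun ε' =>
    ((M.measurable_stream v ε' hm).sub (M.measurable_stream v ε' hg.measurable)).enorm
  calc ∫⁻ x in M.Ω, ‖M.stream v ε φ x - M.stream v δ φ x‖ₑ
      ≤ ∫⁻ x in M.Ω, (‖M.stream v ε φ x - M.stream v ε g x‖ₑ
          + ‖M.stream v δ φ x - M.stream v δ g x‖ₑ
          + ‖M.stream v ε g x - M.stream v δ g x‖ₑ) := by
        refine lintegral_mono fun x => ?_
        have h : M.stream v ε φ x - M.stream v δ φ x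
            = (M.stream v ε φ x - M.stream v ε g x) - (M.stream v δ φ x - M.stream v δ g x)
              + (M.stream v ε g x - M.stream v δ g x) := by ring
        rw [h]
        exact (enorm_add_le _ _).trans (add_le_add enorm_sub_le le_rfl)
    _ ≤ η / 3 + η / 3 + η / 3 := by
        rw [lintegral_add_left (by exact (hmeas ε).add (hmeas δ)), lintegral_add_left (hmeas ε)]
        exact add_le_add (add_le_add (hd ε) (hd δ)) hε
    _ = η := ENNReal.add_thirds η

/-! ### Strong continuity of the evolution family -/

theorem transportFun_apply (t s : ℝ≥0) (f : EuclideanSpace ℝ (Fin d) × M.V → ℝ)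
    (x : EuclideanSpace ℝ (Fin d)) (v : M.V) :
    M.transportFun t s f (x, v)
      = M.absorption t s v * M.stream v (t - s) (fun y => f (y, v)) x := by
  by_cases h : (x, v) ∈ M.reach (t - s)
  · rw [transportFun, indicator_of_mem h, stream,
      indicator_of_mem (s := {x | (x, v) ∈ M.reach (t - s)}) h]
  · rw [transportFun, indicator_of_notMem h, stream,
      indicator_of_notMem (s := {x | (x, v) ∈ M.reach (t - s)}) h, mul_zero]

theorem enorm_transportFun_le (t s : ℝ≥0) (f : EuclideanSpace ℝ (Fin d) × M.V → ℝ)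
    (x : EuclideanSpace ℝ (Fin d)) (v : M.V) :
    ‖M.transportFun t s f (x, v)‖ₑ ≤ ‖M.stream v (t - s) (fun y => f (y, v)) x‖ₑ := by
  rw [transportFun_apply, enorm_mul, Real.enorm_of_nonneg (M.absorption_nonneg t s v)]
  exact mul_le_of_le_one_left' (ENNReal.ofReal_le_one.2 (M.absorption_le_one t s v))

/-- With `v` fixed, the absorption is a scalar `a` multiplying the streamed function `S`, and `aS -
a'S' = a(S - S') + (a - a')S'` separates the two continuity statements. -/
theorem tendsto_lintegral_transportFun {v : M.V}
    (hv : LocallyIntegrable (fun t => (M.Sig t v : ℝ)) halfLine)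
    {f : EuclideanSpace ℝ (Fin d) × M.V → ℝ} (hf : Measurable f)
    (hfv : IntegrableOn (fun x => f (x, v)) M.Ω) {q : ℝ≥0 × ℝ≥0} (hq : q.2 ≤ q.1) :
    Filter.Tendsto (fun p : ℝ≥0 × ℝ≥0 =>
        ∫⁻ x in M.Ω, ‖M.transportFun p.1 p.2 f (x, v) - M.transportFun q.1 q.2 f (x, v)‖ₑ)
      (𝓝[{p | p.2 ≤ p.1}] q) (𝓝 0) := by
  have hm : Measurable fun x => f (x, v) := hf.comp measurable_prodMk_right
  have h1 : Filter.Tendsto (fun p : ℝ≥0 × ℝ≥0 => ∫⁻ x in M.Ω,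
      ‖M.stream v (p.1 - p.2) (fun y => f (y, v)) x - M.stream v (q.1 - q.2) (fun y => f (y, v)) x‖ₑ)
      (𝓝[{p | p.2 ≤ p.1}] q) (𝓝 0) := by
    have hc : Continuous fun p : ℝ≥0 × ℝ≥0 => p.1 - p.2 := by fun_prop
    exact (M.tendsto_lintegral_stream v hm hfv (q.1 - q.2)).comp
      (hc.continuousWithinAt.tendsto)
  have h2 : Filter.Tendsto (fun p : ℝ≥0 × ℝ≥0 =>
      ‖M.absorption p.1 p.2 v - M.absorption q.1 q.2 v‖ₑ * ∫⁻ x in M.Ω, ‖f (x, v)‖ₑ)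
      (𝓝[{p | p.2 ≤ p.1}] q) (𝓝 0) := by
    have h3 := ((M.continuousOn_absorption hv q hq).tendsto.sub_const
      (M.absorption q.1 q.2 v)).enorm
    have h4 := ENNReal.Tendsto.mul_const h3 (b := ∫⁻ x in M.Ω, ‖f (x, v)‖ₑ) (.inr hfv.2.ne)
    simpa using h4
  have h5 := h1.add h2
  rw [add_zero] at h5
  refine tendsto_of_tendsto_of_tendsto_of_le_of_le tendsto_const_nhds h5 (fun _ => zero_le)
    fun p => ?_
  calc ∫⁻ x in M.Ω, ‖M.transportFun p.1 p.2 f (x, v) - M.transportFun q.1 q.2 f (x, v)‖ₑ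
      ≤ ∫⁻ x in M.Ω, (‖M.stream v (p.1 - p.2) (fun y => f (y, v)) x
          - M.stream v (q.1 - q.2) (fun y => f (y, v)) x‖ₑ
        + ‖M.absorption p.1 p.2 v - M.absorption q.1 q.2 v‖ₑ
          * ‖M.stream v (q.1 - q.2) (fun y => f (y, v)) x‖ₑ) := by
        refine lintegral_mono fun x => ?_
        rw [transportFun_apply, transportFun_apply]
        have h : ∀ a a' S S' : ℝ, a * S - a' * S' = a * (S - S') + (a - a') * S' := by
          intros; ring
        rw [h]
        refine (enorm_add_le _ _).trans ?_
        rw [enorm_mul, enorm_mul, Real.enorm_of_nonneg (M.absorption_nonneg p.1 p.2 v)]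
        gcongr
        exact mul_le_of_le_one_left' (ENNReal.ofReal_le_one.2 (M.absorption_le_one p.1 p.2 v))
    _ ≤ _ := by
        rw [lintegral_add_left (by exact ((M.measurable_stream v _ hm).sub
          (M.measurable_stream v _ hm)).enorm), lintegral_const_mul' _ _ enorm_ne_top]
        exact add_le_add le_rfl (mul_le_mul_right (M.lintegral_stream_le v _ _) _)

theorem measurable_transportFun (t s : ℝ≥0) {f : EuclideanSpace ℝ (Fin d) × M.V → ℝ}
    (hf : Measurable f) : Measurable (M.transportFun t s f) :=
  (M.measurable_transportFun_left s hf).comp measurable_prodMk_left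

theorem lintegral_phaseMeasure {F : EuclideanSpace ℝ (Fin d) × M.V → ℝ≥0∞} (hF : Measurable F) :
    ∫⁻ p, F p ∂M.phaseMeasure = ∫⁻ v, (∫⁻ x in M.Ω, F (x, v)) ∂M.velMeasure := by
  rw [phaseMeasure, lintegral_prod_symm _ hF.aemeasurable]

theorem continuousOn_U (f : M.State) :
    ContinuousOn (fun p : ℝ≥0 × ℝ≥0 => M.U p.1 p.2 f) {p | p.2 ≤ p.1} := by
  intro q hq
  have hf := M.measurable_Lp f
  have hdiff : ∀ p : ℝ≥0 × ℝ≥0, Measurable fun z : EuclideanSpace ℝ (Fin d) × M.V =>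
      ‖M.transportFun p.1 p.2 f z - M.transportFun q.1 q.2 f z‖ₑ := fun p =>
    ((M.measurable_transportFun p.1 p.2 hf).sub (M.measurable_transportFun q.1 q.2 hf)).enorm
  have hedist : ∀ p : ℝ≥0 × ℝ≥0, edist (M.U p.1 p.2 f) (M.U q.1 q.2 f)
      = ∫⁻ v, (∫⁻ x in M.Ω,
          ‖M.transportFun p.1 p.2 f (x, v) - M.transportFun q.1 q.2 f (x, v)‖ₑ) ∂M.velMeasure := by
    intro p
    rw [← M.lintegral_phaseMeasure (hdiff p), Lp.edist_def, eLpNorm_one_eq_lintegral_enorm]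
    refine lintegral_congr_ae ?_
    filter_upwards [M.coeFn_U p.1 p.2 f, M.coeFn_U q.1 q.2 f] with z h1 h2
    rw [Pi.sub_apply, h1, h2]
  have hmass : ∫⁻ v, (∫⁻ x in M.Ω, ‖f (x, v)‖ₑ) ∂M.velMeasure ≠ ∞ := by
    rw [← M.lintegral_phaseMeasure hf.enorm, ← enorm_State]
    exact enorm_ne_top
  have hmassm : Measurable fun v => ∫⁻ x in M.Ω, ‖f (x, v)‖ₑ := hf.enorm.lintegral_prod_left'
  have hle : ∀ (p : ℝ≥0 × ℝ≥0) (v : M.V),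
      ∫⁻ x in M.Ω, ‖M.transportFun p.1 p.2 f (x, v)‖ₑ ≤ ∫⁻ x in M.Ω, ‖f (x, v)‖ₑ := fun p v =>
    (lintegral_mono fun x => M.enorm_transportFun_le p.1 p.2 f x v).trans
      (M.lintegral_stream_le v _ _)
  rw [ContinuousWithinAt, tendsto_iff_edist_tendsto_0]
  simp only [hedist]
  rw [← lintegral_zero (μ := M.velMeasure)]
  -- Twice the mass of `f` on the fibre over `v` dominates, because transport at fixed velocity is a
  -- contraction.
  refine tendsto_lintegral_filter_of_dominated_convergence
    (fun v => (∫⁻ x in M.Ω, ‖f (x, v)‖ₑ) + ∫⁻ x in M.Ω, ‖f (x, v)‖ₑ)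
    (.of_forall fun p => (hdiff p).lintegral_prod_left')
    (.of_forall fun p => .of_forall fun v => ?_) ?_ ?_
  · calc _ ≤ ∫⁻ x in M.Ω, (‖M.transportFun p.1 p.2 f (x, v)‖ₑ
          + ‖M.transportFun q.1 q.2 f (x, v)‖ₑ) := lintegral_mono fun x => enorm_sub_le
      _ ≤ _ := by
        rw [lintegral_add_left
          (by exact ((M.measurable_transportFun p.1 p.2 hf).comp measurable_prodMk_right).enorm)]
        exact add_le_add (hle p v) (hle q v)
  · rw [lintegral_add_left hmassm]
    exact ENNReal.add_ne_top.2 ⟨hmass, hmass⟩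
  · filter_upwards [M.ae_locallyIntegrable_Sig, ae_lt_top hmassm hmass] with v hv hfin
    exact M.tendsto_lintegral_transportFun hv hf
      ⟨(hf.comp measurable_prodMk_right).aestronglyMeasurable, hfin⟩ hq

/-! ### Assembly of the substochastic evolution family and its perturbation -/

theorem isEvolutionFamily_U : IsEvolutionFamily M.U where
  continuousOn := M.continuousOn_U
  comp := M.U_comp
  refl := M.U_self
  bound := by
    -- The operators are contractions, so any positive growth rate serves; `β = 1` is arbitrary.
    refine ⟨1, 1, one_pos, one_pos, fun t s hst => (M.norm_U_le t s).trans ?_⟩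
    rw [one_mul, one_mul]
    exact Real.one_le_exp (sub_nonneg.2 (by exact_mod_cast hst))

theorem norm_U_apply_le (t s : ℝ≥0) (f : M.State) : ‖M.U t s f‖ ≤ ‖f‖ :=
  ((M.U t s).le_of_opNorm_le (M.norm_U_le t s) f).trans_eq (one_mul _)

theorem substochasticPerturbation : SubstochasticPerturbation M.U M.B where
  evolution := M.isEvolutionFamily_U
  nonneg t s _ _ hf := M.U_nonneg t s hf
  norm_le t s _ f _ := M.norm_U_apply_le t s f
  perturbation_nonneg := M.B_nonneg
  mem_domain := M.ae_U_mem_B_domain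
  measurable s f := (M.stronglyMeasurable_B_U s f).aestronglyMeasurable
  dissipation _ _ hst f _ := ⟨M.integrableOn_B_U hst f,
    (M.integral_norm_B_U_le hst f).trans (M.integral_norm_SigOp_U_le hst f)⟩

end KineticModel

theorem mainTheorem9 {d : ℕ} (M : KineticModel d) :
    (∀ᵐ t ∂halfLine, (M.SigOp t).domain ≤ (M.B t).domain) ∧
    (∀ (s : ℝ≥0) (f : M.State), ∀ᵐ t ∂halfLine, s ≤ t →
      M.U t s f ∈ (M.SigOp t).domain ∧ M.U t s f ∈ (M.B t).domain) ∧
    (∀ (s : ℝ≥0) (f : M.State),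
      AEStronglyMeasurable (fun t => (M.B t).applyOrZero (M.U t s f))
        (halfLine.restrict (Ici s))) ∧
    (∀ s r : ℝ≥0, s ≤ r → ∀ f : M.State, 0 ≤ f →
      IntegrableOn (fun t => ‖(M.B t).applyOrZero (M.U t s f)‖) (Icc s r) halfLine ∧
      IntegrableOn (fun t => ‖(M.SigOp t).applyOrZero (M.U t s f)‖) (Icc s r) halfLine ∧
      ∫ t in Icc s r, ‖(M.B t).applyOrZero (M.U t s f)‖ ∂halfLine
        ≤ ∫ t in Icc s r, ‖(M.SigOp t).applyOrZero (M.U t s f)‖ ∂halfLine ∧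
      ∫ t in Icc s r, ‖(M.SigOp t).applyOrZero (M.U t s f)‖ ∂halfLine
        ≤ ‖f‖ - ‖M.U r s f‖) ∧
    SubstochasticPerturbation M.U M.B := by
  refine ⟨M.ae_SigOp_domain_le, fun s f => ?_,
    fun s f => (M.stronglyMeasurable_B_U s f).aestronglyMeasurable,
    fun s r hsr f _ => ⟨(M.integrableOn_B_U hsr f).norm, M.integrableOn_norm_SigOp_U hsr f,
      M.integral_norm_B_U_le hsr f, M.integral_norm_SigOp_U_le hsr f⟩,
    M.substochasticPerturbation⟩
  filter_upwards [M.ae_U_mem_SigOp_domain s f, M.ae_U_mem_B_domain s f] with t h1 h2 hst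
  exact ⟨h1 hst, h2 hst⟩
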